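/- Let $m \ge 3$ and let $D \subset \mathbb{R}^m$ be a bounded Lipschitz domain, that is, a nonempty bounded connected open set which near each of its boundary points is, in suitable orthogonal coordinates, the set of points strictly above the graph of a Lipschitz function. Let $$E_m(z) = \frac{1}{(2-m)\,\omega_m\,|z|^{m-2}}, \qquad \omega_m = \frac{2\pi^{m/2}}{\Gamma(m/2)},$$ be the fundamental solution of the Laplace equation, and let $T$ be the Newtonian potential operator $$(Tu)(x) = \int_D E_m(x-y)\,u(y)\,dy .$$ For every $u \in L^2(D)$ this integral converges absolutely for almost every $x \in D$, and $T$ is a bounded linear operator on $L^2(D)$. Let $\mu \in \mathbb{R}\setminus\{0\}$. Then $I - \mu^2 T$ has a bounded inverse $(I-\mu^2T)^{-1} : L^2(D) \to L^2(D)$. Moreover, let $\alpha \in (0,1)$ and suppose that $h \in C^{0,\alpha}(\overline D)$ is a real-valued function that is harmonic in $D$. Then the integral equation $$u - \mu^2\, T u = h \quad \text{in } D$$ has a solution $u \in L^2(D)$, unique up to equality almost everywhere. This solution, $u = (I-\mu^2T)^{-1}h$, (after a change on a null set) satisfies the equation at every point of $D$, belongs to $C^{0,\alpha}(\overline D)$,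 and is $\mu$-panharmonic in $D$, that is, $u \in C^2(D)$ and $\nabla^2 u - \mu^2 u = 0$ in $D$. Thus $(I-\mu^2T)^{-1}$ maps each function in $C^{0,\alpha}(\overline D)$ that is harmonic in $D$ to a function in $C^{0,\alpha}(\overline D)$ that is $\mu$-panharmonic in $D$. -/

import Mathlib

open MeasureTheory
open scoped NNReal Laplacian

noncomputable section

/-- The space `ℝ^m` with its Euclidean structure. -/
abbrev Euc (m : ℕ) : Type := EuclideanSpace ℝ (Fin m)

/-- A bounded Lipschitz domain: a nonempty, bounded, connected open set which, near each of its
boundary points and in suitable orthogonal coordinates, is the part of space strictly above the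
graph of a Lipschitz function. Here `e` is the unit vector of the vertical axis, `inner ℝ e x` is
the vertical coordinate of `x`, and `x - inner ℝ e x • e` is the projection of `x` to the
hyperplane orthogonal to `e`; only the values of `φ` on that hyperplane matter. -/
structure IsBoundedLipschitzDomain {m : ℕ} (D : Set (Euc m)) : Prop where
  isOpen : IsOpen D
  isConnected : IsConnected D
  isBounded : Bornology.IsBounded D
  lipschitz_boundary : ∀ p ∈ frontier D, ∃ (e : Euc m) (r : ℝ) (K : ℝ≥0) (φ : Euc m → ℝ),
    ‖e‖ = 1 ∧ 0 < r ∧ LipschitzWith K φ ∧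
      ∀ x ∈ Metric.ball p r, x ∈ D ↔ φ (x - inner ℝ e x • e) < inner ℝ e x

/-- The area of the unit sphere of `ℝ^m`. -/
def sphereArea (m : ℕ) : ℝ := 2 * Real.pi ^ ((m : ℝ) / 2) / Real.Gamma ((m : ℝ) / 2)

/-- The fundamental solution of the Laplace equation in `ℝ^m`, for `m ≥ 3`. -/
def fundamentalSolution (m : ℕ) (z : Euc m) : ℝ :=
  ((2 - (m : ℝ)) * sphereArea m * ‖z‖ ^ (m - 2))⁻¹

/-- The Newtonian potential `(T u)(x) = ∫_D E_m(x - y) u(y) dy`. -/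
def newtonianPotential {m : ℕ} (D : Set (Euc m)) (u : Euc m → ℝ) (x : Euc m) : ℝ :=
  ∫ y in D, fundamentalSolution m (x - y) * u y

/-- The Hilbert space `L²(D)`. -/
abbrev L2 {m : ℕ} (D : Set (Euc m)) : Type := Lp ℝ 2 (volume.restrict D)

/-- `T` is the bounded operator of `L²(D)` given by the Newtonian potential: for each `f` in
`L²(D)` the integral converges absolutely for almost every `x` in `D`, and its value is
`(T f)(x)`. At most one operator has this property. -/
def IsNewtonianOperator {m : ℕ} (D : Set (Euc m)) (T : L2 D →L[ℝ] L2 D) : Prop :=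
  ∀ f : L2 D, ∀ᵐ x ∂(volume.restrict D),
    IntegrableOn (fun y => fundamentalSolution m (x - y) * f y) D ∧
      T f x = newtonianPotential D f x

/-- `u` is an `L²(D)`-solution of the integral equation `u - lam * T u = h` in `D`. -/
def IsL2Solution {m : ℕ} (D : Set (Euc m)) (lam : ℝ) (h u : Euc m → ℝ) : Prop :=
  MemLp u 2 (volume.restrict D) ∧
    ∀ᵐ x ∂(volume.restrict D), u x - lam * newtonianPotential D u x = h x

/-- `u` belongs to `C^{0,α}(closure D)`; only the values on the closure of `D` matter. -/
def IsHolderOnClosure {m : ℕ} (α : ℝ≥0) (u : Euc m → ℝ) (D : Set (Euc m)) : Prop :=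
  ∃ C : ℝ≥0, HolderOnWith C α u (closure D)

/-- `u` is `μ`-panharmonic in the open set `D`: it is of class `C²` there and satisfies
`∇²u - μ²u = 0`. -/
def IsPanharmonicOn {m : ℕ} (μ : ℝ) (u : Euc m → ℝ) (D : Set (Euc m)) : Prop :=
  ContDiffOn ℝ 2 u D ∧ ∀ x ∈ D, (Δ u) x - μ ^ 2 * u x = 0

end

/-!
Up to a negative factor the fundamental solution is the Riesz kernel `‖x - y‖ ^ (2 - m)`, which is a
superposition of Gaussians with positive weights and hence positive semidefinite. So `⟪T f, f⟫ ≤ 0`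
on `L²(D)`, the operator `1 - μ² T` is coercive, and it is invertible. On the continuous functions
on `closure D` the Newtonian potential is a compact operator, by Arzelà–Ascoli, so the uniqueness in
`L²(D)` and the Fredholm alternative give a continuous solution `u` for continuous `h`. The
potential of a bounded density is Lipschitz, so `u = h + μ² T u` is as Hölder as `h`. It is even of
class `C¹`, which bootstraps: near a point of `D` the density `u` is `C¹`, whence `T u` is `C²` with
`Δ (T u) = u`, and `u` is panharmonic because `h` is harmonic.
-/

open Set Metric Filter Topology
open scoped Pointwise ENNReal Convolution

section SingularConvolution

variable {E F F' G : Type*} [NormedAddCommGroup E] [NormedAddCommGroup F] [NormedSpace ℝ F]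
  [NormedAddCommGroup F'] [NormedSpace ℝ F'] [NormedAddCommGroup G] [NormedSpace ℝ G]
  {k : E → F} {f : E → F'} {B : ℝ}

theorem norm_convolution_le [MeasurableSpace E] {μ : Measure E} (L : F →L[ℝ] F' →L[ℝ] G) {S : Set E}
    {x : E} (hk : IntegrableOn k S μ) (hB : ∀ y, ‖f y‖ ≤ B) (hf : ∀ t ∉ S, f (x - t) = 0) :
    ‖(k ⋆[L, μ] f) x‖ ≤ ‖L‖ * (∫ t in S, ‖k t‖ ∂μ) * B := by
  rw [convolution_def, ← setIntegral_eq_integral_of_forall_compl_eq_zero (s := S)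
    fun t ht => by rw [hf t ht, map_zero]]
  calc _ ≤ ∫ t in S, ‖L‖ * ‖k t‖ * B ∂μ :=
        norm_integral_le_of_norm_le ((hk.norm.const_mul _).mul_const _)
          (Eventually.of_forall fun t => (L.le_opNorm₂ _ _).trans (by gcongr; exact hB _))
    _ = _ := by rw [integral_mul_const, integral_const_mul]

variable [NormedSpace ℝ E]

theorem integral_fderiv_segment [CompleteSpace G] {x h : E} (A : F →L[ℝ] G)
    (hk : ContDiffOn ℝ 1 k {0}ᶜ) (hx : ∀ t : ℝ, x + t • h ≠ 0) :
    ∫ t in (0 : ℝ)..1, A (fderiv ℝ k (x + t • h) h) = A (k (x + h)) - A (k x) := by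
  have hline (t : ℝ) : HasDerivAt (fun t : ℝ => x + t • h) h t := by
    simpa using ((hasDerivAt_id t).smul_const h).const_add x
  have hderiv (t : ℝ) :
      HasDerivAt (fun t : ℝ => A (k (x + t • h))) (A (fderiv ℝ k (x + t • h) h)) t :=
    A.hasFDerivAt.comp_hasDerivAt t
      (((hk.contDiffAt (isOpen_compl_singleton.mem_nhds (hx t))).differentiableAt
        one_ne_zero).hasFDerivAt.comp_hasDerivAt t (hline t))
  have hcont : Continuous fun t : ℝ => A (fderiv ℝ k (x + t • h) h) :=
    A.continuous.comp (((hk.continuousOn_fderiv_of_isOpen isOpen_compl_singleton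
      le_rfl).comp_continuous (by fun_prop) hx).clm_apply continuous_const)
  rw [intervalIntegral.integral_eq_sub_of_hasDerivAt (fun t _ => hderiv t)
    (hcont.intervalIntegrable 0 1)]
  simp only [one_smul, zero_smul, add_zero]

theorem hasFDerivAt_of_add_sub_eq_integral [CompleteSpace F] {Φ : E → F}
    {Φ' : E → E →L[ℝ] F} (hΦ' : Continuous Φ')
    (h : ∀ x h, Φ (x + h) - Φ x = ∫ t in (0 : ℝ)..1, Φ' (x + t • h) h) (x : E) :
    HasFDerivAt Φ (Φ' x) x := by
  refine .of_isLittleO (Asymptotics.isLittleO_iff.2 fun ε hε => ?_)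
  obtain ⟨δ, hδ, hball⟩ := Metric.continuous_iff.1 hΦ' x ε hε
  filter_upwards [ball_mem_nhds x hδ] with y hy
  have hdiff : Φ y - Φ x - Φ' x (y - x) =
      ∫ t in (0 : ℝ)..1, (Φ' (x + t • (y - x)) - Φ' x) (y - x) := by
    have hcont : Continuous fun t : ℝ => Φ' (x + t • (y - x)) (y - x) :=
      (hΦ'.comp (by fun_prop)).clm_apply continuous_const
    simp_rw [sub_apply]
    rw [intervalIntegral.integral_sub (hcont.intervalIntegrable 0 1)
      intervalIntegrable_const, ← h]
    simp only [add_sub_cancel, intervalIntegral.integral_const, sub_zero, one_smul]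
  rw [hdiff]
  have hle : ∀ t ∈ uIoc (0 : ℝ) 1, ‖(Φ' (x + t • (y - x)) - Φ' x) (y - x)‖ ≤ ε * ‖y - x‖ := by
    intro t ht
    rw [uIoc_of_le zero_le_one] at ht
    refine (Φ' (x + t • (y - x)) - Φ' x).le_of_opNorm_le ?_ _
    rw [← dist_eq_norm]
    refine (hball _ ?_).le
    rw [mem_ball, dist_eq_norm] at hy
    rw [dist_self_add_left, norm_smul, Real.norm_of_nonneg ht.1.le]
    exact (mul_le_of_le_one_left (norm_nonneg _) ht.2).trans_lt hy
  simpa using intervalIntegral.norm_integral_le_of_norm_le_const hle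

variable [FiniteDimensional ℝ E] [MeasurableSpace E] {μ : Measure E}

theorem exists_norm_convolution_le (L : F →L[ℝ] F' →L[ℝ] G) (hk : LocallyIntegrable k μ)
    {S D : Set E} (hS : Bornology.IsBounded S) (hD : Bornology.IsBounded D) :
    ∃ M : ℝ, 0 ≤ M ∧ ∀ (f : E → F') (B : ℝ), (∀ y, ‖f y‖ ≤ B) → Function.support f ⊆ D →
      ∀ x ∈ S, ‖(k ⋆[L, μ] f) x‖ ≤ M * B := by
  have hK : IsCompact (closure (S - D)) := (hS.sub hD).isCompact_closure
  refine ⟨‖L‖ * ∫ t in closure (S - D), ‖k t‖ ∂μ, by positivity, fun f B hB hf x hx => ?_⟩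
  refine norm_convolution_le L (hk.integrableOn_isCompact hK) hB fun t ht => ?_
  by_contra h0
  exact ht (subset_closure ⟨x, hx, x - t, hf h0, sub_sub_cancel x t⟩)

variable [BorelSpace E] [μ.IsAddHaarMeasure]

theorem convolutionExists_of_bounded (L : F →L[ℝ] F' →L[ℝ] G) (hk : LocallyIntegrable k μ)
    (hf : AEStronglyMeasurable f μ) (hB : ∀ y, ‖f y‖ ≤ B) (hfc : HasCompactSupport f) :
    ConvolutionExists k f L μ := by
  intro x
  have hK : IsCompact ((x - ·) ⁻¹' tsupport f) :=
    (Homeomorph.subLeft x).isCompact_preimage.2 hfc.isCompact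
  refine BddAbove.convolutionExistsAt (s := (x - ·) ⁻¹' tsupport f) L ?_ hK.measurableSet
    (fun t ht => subset_tsupport f fun h0 => ht ?_) (hk.integrableOn_isCompact hK) hf
  · exact ⟨B, by rintro - ⟨y, -, rfl⟩; exact hB y⟩
  · simp [h0]

theorem continuous_convolution_of_integrable (L : F →L[ℝ] F' →L[ℝ] G) (hk : Integrable k μ)
    (hf : AEStronglyMeasurable f μ) (hB : ∀ y, ‖f y‖ ≤ B) :
    Continuous (k ⋆[L, μ] f) := by
  have hexists {k : E → F} (hk : Integrable k μ) : ConvolutionExists k f L μ := fun x =>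
    BddAbove.convolutionExistsAt (s := univ) L ⟨B, by rintro - ⟨y, -, rfl⟩; exact hB y⟩
      .univ (subset_univ _) hk.integrableOn hf
  have hfloc : LocallyIntegrable f μ :=
    (locallyIntegrable_const B).mono hf (Eventually.of_forall fun y =>
      (hB y).trans (le_abs_self B))
  refine continuous_of_uniform_approx_of_continuous fun u hu => ?_
  obtain ⟨ε, hε, hu⟩ := mem_uniformity_dist.1 hu
  have hpos : 0 < ‖L‖ * |B| + 1 := by positivity
  obtain ⟨k', hk'c, hk'ε, hk'cont, hk'⟩ :=
    hk.exists_hasCompactSupport_integral_sub_le (half_pos (div_pos hε hpos))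
  refine ⟨k' ⋆[L, μ] f, hk'c.continuous_convolution_left L hk'cont hfloc, fun x => hu ?_⟩
  have hsub : (k ⋆[L, μ] f) x - (k' ⋆[L, μ] f) x = ((k - k') ⋆[L, μ] f) x := by
    simp_rw [convolution_def, Pi.sub_apply, map_sub, sub_apply]
    exact (integral_sub (hexists hk x) (hexists hk' x)).symm
  rw [dist_eq_norm, hsub]
  calc ‖((k - k') ⋆[L, μ] f) x‖ ≤ ‖L‖ * (∫ t in univ, ‖(k - k') t‖ ∂μ) * |B| :=
        norm_convolution_le L (hk.sub hk').integrableOn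
          (fun y => (hB y).trans (le_abs_self B)) (by simp)
    _ ≤ ‖L‖ * (ε / (‖L‖ * |B| + 1) / 2) * |B| := by
        rw [setIntegral_univ]; gcongr; exact hk'ε
    _ = ε / 2 * ((‖L‖ * |B|) / (‖L‖ * |B| + 1)) := by ring
    _ ≤ ε / 2 * 1 := by gcongr; exact div_le_one_of_le₀ (by linarith) hpos.le
    _ < ε := by linarith

theorem continuous_convolution_of_bounded (L : F →L[ℝ] F' →L[ℝ] G) (hk : LocallyIntegrable k μ)
    (hf : AEStronglyMeasurable f μ) (hB : ∀ y, ‖f y‖ ≤ B) (hfc : HasCompactSupport f) :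
    Continuous (k ⋆[L, μ] f) := by
  refine continuous_iff_continuousAt.2 fun x => ?_
  obtain ⟨R, hR⟩ := hfc.isCompact.isBounded.subset_closedBall x
  have hint : Integrable ((closedBall 0 (R + 1)).indicator k) μ :=
    (hk.integrableOn_isCompact (isCompact_closedBall _ _)).integrable_indicator
      measurableSet_closedBall
  refine ((continuous_convolution_of_integrable L hint hf hB).continuousAt (x := x)).congr ?_
  filter_upwards [ball_mem_nhds x one_pos] with x' hx'
  refine integral_congr_ae (Eventually.of_forall fun t => ?_)
  by_cases ht : t ∈ closedBall 0 (R + 1)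
  · simp only [indicator_of_mem ht]
  · have : f (x' - t) = 0 := by
      by_contra h0
      have h1 := hR (subset_tsupport f h0)
      rw [mem_ball_iff_norm] at hx'
      rw [mem_closedBall_iff_norm] at h1
      refine ht (mem_closedBall_zero_iff.2 ?_)
      calc ‖t‖ = ‖(x' - x) - (x' - t - x)‖ := by congr 1; abel
        _ ≤ ‖x' - x‖ + ‖x' - t - x‖ := norm_sub_le _ _
        _ ≤ R + 1 := by linarith
    simp only [this, map_zero]

theorem ae_forall_add_smul_ne_zero (hE : 2 ≤ Module.finrank ℝ E) (h : E) :
    ∀ᵐ z ∂μ, ∀ t : ℝ, z + t • h ≠ 0 := by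
  have htop : Submodule.span ℝ {h} ≠ ⊤ := fun htop => by
    have := finrank_span_le_card (R := ℝ) {h}
    rw [htop, finrank_top, toFinset_singleton, Finset.card_singleton] at this
    omega
  filter_upwards [measure_eq_zero_iff_ae_notMem.1 (Measure.addHaar_submodule μ _ htop)]
    with z hz t hzt
  exact hz (Submodule.mem_span_singleton.2 ⟨-t, by rw [neg_smul, eq_neg_of_add_eq_zero_left hzt]⟩)

theorem integrable_convolution_integrand_segment (L : F →L[ℝ] F' →L[ℝ] G)
    (hk : LocallyIntegrable k μ) (hf : AEStronglyMeasurable f μ) (hB : ∀ y, ‖f y‖ ≤ B)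
    (hfc : HasCompactSupport f) (x h : E) :
    Integrable (fun p : E × ℝ => L (k (x + p.2 • h - p.1)) (f p.1))
      (μ.prod (volume.restrict (Ioc 0 1))) := by
  have hqmp : Measure.QuasiMeasurePreserving (fun p : E × ℝ => x + p.2 • h - p.1)
      (μ.prod (volume.restrict (Ioc 0 1))) μ :=
    QuasiMeasurePreserving.prod_of_left (by fun_prop) (Eventually.of_forall fun t =>
      (Measure.measurePreserving_sub_left μ (x + t • h)).quasiMeasurePreserving)
  have hkm := hk.aestronglyMeasurable.comp_quasiMeasurePreserving hqmp
  have hk' : LocallyIntegrable (‖k ·‖) μ := fun z => (hk z).norm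
  have hconv (z : E) : Integrable (fun y => ‖k (z - y)‖ * ‖f y‖) μ :=
    (convolutionExists_of_bounded (.mul ℝ ℝ) hk' hf.norm (by simpa using hB) hfc.norm
      z).integrable_swap
  have hcont : Continuous ((‖k ·‖) ⋆[.mul ℝ ℝ, μ] (‖f ·‖)) :=
    continuous_convolution_of_bounded (.mul ℝ ℝ) hk' hf.norm (by simpa using hB) hfc.norm
  have hdom : Integrable (fun p : E × ℝ => ‖k (x + p.2 • h - p.1)‖ * ‖f p.1‖)
      (μ.prod (volume.restrict (Ioc 0 1))) := by
    refine (integrable_prod_iff' (hkm.norm.mul hf.comp_fst.norm)).2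
      ⟨Eventually.of_forall fun t => hconv (x + t • h), ?_⟩
    have : (fun t : ℝ => ∫ y, ‖k (x + t • h - y)‖ * ‖f y‖ ∂μ) =
        fun t => ((‖k ·‖) ⋆[.mul ℝ ℝ, μ] (‖f ·‖)) (x + t • h) := by
      simp only [convolution_mul_swap]
    simp only [Pi.mul_apply, Function.comp_apply, norm_mul, norm_norm, this]
    exact (hcont.comp (by fun_prop)).integrableOn_Ioc
  refine (hdom.const_mul ‖L‖).mono' ?_ (Eventually.of_forall fun p => ?_)
  · exact L.aestronglyMeasurable_comp₂ hkm hf.comp_fst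
  · rw [← mul_assoc]
    exact L.le_opNorm₂ _ _

theorem convolution_add_sub_convolution [CompleteSpace G]
    (L : F →L[ℝ] F' →L[ℝ] G) (hE : 2 ≤ Module.finrank ℝ E) (hk : LocallyIntegrable k μ)
    (hkd : ContDiffOn ℝ 1 k {0}ᶜ) (hdk : LocallyIntegrable (fderiv ℝ k) μ)
    (hf : AEStronglyMeasurable f μ) (hB : ∀ y, ‖f y‖ ≤ B) (hfc : HasCompactSupport f) (x h : E) :
    (k ⋆[L, μ] f) (x + h) - (k ⋆[L, μ] f) x =
      ∫ t in (0 : ℝ)..1, (fderiv ℝ k ⋆[L.precompL E, μ] f) (x + t • h) h := by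
  have hconv := convolutionExists_of_bounded L hk hf hB hfc
  have hdconv := convolutionExists_of_bounded (L.precompL E) hdk hf hB hfc
  have hdkh : LocallyIntegrable (fun z => fderiv ℝ k z h) μ :=
    fun z => let ⟨s, hs, hi⟩ := hdk z; ⟨s, hs, hi.apply_continuousLinearMap h⟩
  have hsegment : ∀ᵐ y ∂μ, L (k (x + h - y)) (f y) - L (k (x - y)) (f y) =
      ∫ t in Ioc (0 : ℝ) 1, L (fderiv ℝ k (x + t • h - y) h) (f y) := by
    filter_upwards [((Measure.measurePreserving_sub_left μ x).quasiMeasurePreserving.ae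
      (ae_forall_add_smul_ne_zero hE h))] with y hy
    rw [add_sub_right_comm, ← intervalIntegral.integral_of_le zero_le_one]
    simp_rw [add_sub_right_comm]
    exact (integral_fderiv_segment (L.flip (f y)) hkd hy).symm
  have happly : ∀ z, (fderiv ℝ k ⋆[L.precompL E, μ] f) z h =
      ∫ y, L (fderiv ℝ k (z - y) h) (f y) ∂μ := fun z => by
    rw [convolution_eq_swap, ContinuousLinearMap.integral_apply (hdconv z).integrable_swap]
    rfl
  simp_rw [happly, intervalIntegral.integral_of_le zero_le_one, convolution_eq_swap]
  rw [← integral_sub (hconv _).integrable_swap (hconv _).integrable_swap,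
    integral_congr_ae hsegment]
  exact integral_integral_swap
    (integrable_convolution_integrand_segment L hdkh hf hB hfc x h)

theorem hasFDerivAt_convolution_of_contDiffOn_compl [CompleteSpace G]
    (L : F →L[ℝ] F' →L[ℝ] G) (hE : 2 ≤ Module.finrank ℝ E) (hk : LocallyIntegrable k μ)
    (hkd : ContDiffOn ℝ 1 k {0}ᶜ) (hdk : LocallyIntegrable (fderiv ℝ k) μ)
    (hf : AEStronglyMeasurable f μ) (hB : ∀ y, ‖f y‖ ≤ B) (hfc : HasCompactSupport f) (x : E) :
    HasFDerivAt (k ⋆[L, μ] f) ((fderiv ℝ k ⋆[L.precompL E, μ] f) x) x :=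
  hasFDerivAt_of_add_sub_eq_integral (continuous_convolution_of_bounded _ hdk hf hB hfc)
    (convolution_add_sub_convolution L hE hk hkd hdk hf hB hfc) x

theorem exists_lipschitz_convolution [CompleteSpace G]
    (L : F →L[ℝ] F' →L[ℝ] G) (hE : 2 ≤ Module.finrank ℝ E) (hk : LocallyIntegrable k μ)
    (hkd : ContDiffOn ℝ 1 k {0}ᶜ) (hdk : LocallyIntegrable (fderiv ℝ k) μ)
    {S D : Set E} (hS : Bornology.IsBounded S) (hD : Bornology.IsBounded D) :
    ∃ M : ℝ, 0 ≤ M ∧ ∀ (f : E → F') (B : ℝ), AEStronglyMeasurable f μ → (∀ y, ‖f y‖ ≤ B) →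
      Function.support f ⊆ D →
        ∀ x ∈ S, ∀ y ∈ S, ‖(k ⋆[L, μ] f) x - (k ⋆[L, μ] f) y‖ ≤ M * B * ‖x - y‖ := by
  obtain ⟨R, hR⟩ := hS.subset_closedBall 0
  obtain ⟨M, hM0, hM⟩ :=
    exists_norm_convolution_le (L.precompL E) hdk (isBounded_closedBall (x := 0) (r := R)) hD
  refine ⟨M, hM0, fun f B hf hB hfD x hx y hy => ?_⟩
  have hfc : HasCompactSupport f := hD.isCompact_closure.of_isClosed_subset
    (isClosed_tsupport f) (closure_mono hfD)
  exact (convex_closedBall (0 : E) R).norm_image_sub_le_of_norm_hasFDerivWithin_le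
    (fun z _ => (hasFDerivAt_convolution_of_contDiffOn_compl L hE hk hkd hdk hf hB hfc
      z).hasFDerivWithinAt) (fun z hz => hM f B hB hfD z hz) (hR hy) (hR hx)

end SingularConvolution

section SchurTest

variable {X Y 𝕜 : Type*} [MeasurableSpace X] [MeasurableSpace Y] [RCLike 𝕜] {μ : Measure X}
  {ν : Measure Y}

theorem sq_lintegral_mul_le {k w : X → ℝ≥0∞} (hk : AEMeasurable k μ) (hw : AEMeasurable w μ) :
    (∫⁻ x, k x * w x ∂μ) ^ 2 ≤ (∫⁻ x, k x ∂μ) * ∫⁻ x, k x * w x ^ 2 ∂μ := by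
  have hsqrt (a b : ℝ≥0∞) : a ^ (1 / 2 : ℝ) * (a * b ^ 2) ^ (1 / 2 : ℝ) = a * b := by
    rw [← ENNReal.mul_rpow_of_nonneg _ _ (by positivity), ← mul_assoc, ← sq, ← mul_pow,
      ← ENNReal.rpow_two, ← ENNReal.rpow_mul]
    norm_num
  have hsq (a : ℝ≥0∞) : (a ^ (1 / 2 : ℝ)) ^ 2 = a := by
    rw [← ENNReal.rpow_two, ← ENNReal.rpow_mul]
    norm_num
  have h := ENNReal.lintegral_mul_norm_pow_le (p := 1 / 2) (q := 1 / 2) hk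
    (hk.mul (hw.pow_const 2)) (by norm_num) (by norm_num) (by norm_num)
  simp only [Pi.mul_apply, hsqrt] at h
  calc _ ≤ ((∫⁻ x, k x ∂μ) ^ (1 / 2 : ℝ) * (∫⁻ x, k x * w x ^ 2 ∂μ) ^ (1 / 2 : ℝ)) ^ 2 := by
        gcongr
    _ = _ := by rw [mul_pow, hsq, hsq]

variable [SFinite μ] [SFinite ν] {R C : ℝ≥0∞}

section Nonneg

variable {k : X → Y → ℝ≥0∞} {w : Y → ℝ≥0∞}

theorem lintegral_lintegral_kernel_mul_le (hk : Measurable k.uncurry)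
    (hcol : ∀ᵐ y ∂ν, ∫⁻ x, k x y ∂μ ≤ C) (hw : AEMeasurable w ν) :
    ∫⁻ x, ∫⁻ y, k x y * w y ∂ν ∂μ ≤ C * ∫⁻ y, w y ∂ν := by
  rw [lintegral_lintegral_swap (hk.aemeasurable.mul hw.comp_snd), ← lintegral_const_mul'' _ hw]
  refine lintegral_mono_ae (hcol.mono fun y hy => ?_)
  rw [lintegral_mul_const _ (f := (k · y)) (hk.comp measurable_prodMk_right)]
  gcongr

theorem lintegral_sq_lintegral_kernel_mul_le (hk : Measurable k.uncurry)
    (hrow : ∀ᵐ x ∂μ, ∫⁻ y, k x y ∂ν ≤ R) (hcol : ∀ᵐ y ∂ν, ∫⁻ x, k x y ∂μ ≤ C)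
    (hw : AEMeasurable w ν) :
    ∫⁻ x, (∫⁻ y, k x y * w y ∂ν) ^ 2 ∂μ ≤ R * C * ∫⁻ y, w y ^ 2 ∂ν := by
  have hw2 : AEMeasurable (fun y => w y ^ 2) ν := hw.pow_const 2
  calc _ ≤ ∫⁻ x, R * ∫⁻ y, k x y * w y ^ 2 ∂ν ∂μ := lintegral_mono_ae <|
        hrow.mono fun x hx => (sq_lintegral_mul_le
          (hk.comp measurable_prodMk_left).aemeasurable hw).trans (mul_left_mono hx)
    _ = R * ∫⁻ x, ∫⁻ y, k x y * w y ^ 2 ∂ν ∂μ :=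
        lintegral_const_mul'' _ (hk.aemeasurable.mul hw2.comp_snd).lintegral_prod_right'
    _ ≤ R * (C * ∫⁻ y, w y ^ 2 ∂ν) := by
        gcongr
        exact lintegral_lintegral_kernel_mul_le hk hcol hw2
    _ = _ := (mul_assoc _ _ _).symm

end Nonneg

variable {K : X → Y → 𝕜} {f : Y → 𝕜}

theorem integrable_prod_kernel_mul (hK : Measurable K.uncurry)
    (hcol : ∀ᵐ y ∂ν, ∫⁻ x, ‖K x y‖ₑ ∂μ ≤ C) (hC : C ≠ ∞) (hf : Integrable f ν) :
    Integrable (fun p : X × Y => K p.1 p.2 * f p.2) (μ.prod ν) := by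
  have hmeas : AEStronglyMeasurable (fun p : X × Y => K p.1 p.2 * f p.2) (μ.prod ν) :=
    hK.aestronglyMeasurable.mul hf.1.comp_snd
  refine ⟨hmeas, ?_⟩
  rw [hasFiniteIntegral_iff_enorm, lintegral_prod _ hmeas.enorm]
  simp_rw [enorm_mul]
  exact (lintegral_lintegral_kernel_mul_le hK.enorm hcol hf.1.enorm).trans_lt
    (ENNReal.mul_lt_top hC.lt_top hf.2)

theorem ae_integrable_kernel_mul (hK : Measurable K.uncurry)
    (hrow : ∀ᵐ x ∂μ, ∫⁻ y, ‖K x y‖ₑ ∂ν ≤ R) (hcol : ∀ᵐ y ∂ν, ∫⁻ x, ‖K x y‖ₑ ∂μ ≤ C) (hR : R ≠ ∞)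
    (hC : C ≠ ∞) (hf : MemLp f 2 ν) : ∀ᵐ x ∂μ, Integrable (fun y => K x y * f y) ν := by
  have hfin : ∫⁻ x, (∫⁻ y, ‖K x y‖ₑ * ‖f y‖ₑ ∂ν) ^ 2 ∂μ ≠ ∞ := by
    refine ne_top_of_le_ne_top ?_
      (lintegral_sq_lintegral_kernel_mul_le hK.enorm hrow hcol hf.1.enorm)
    refine ENNReal.mul_ne_top (ENNReal.mul_ne_top hR hC) ?_
    simpa using (lintegral_rpow_enorm_lt_top_of_eLpNorm_lt_top two_ne_zero (by simp) hf.2).ne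
  have hmeas : AEMeasurable (fun x => (∫⁻ y, ‖K x y‖ₑ * ‖f y‖ₑ ∂ν) ^ 2) μ :=
    (hK.enorm.aemeasurable.mul hf.1.enorm.comp_snd).lintegral_prod_right'.pow_const 2
  filter_upwards [ae_lt_top' hmeas hfin] with x hx
  refine ⟨(hK.comp measurable_prodMk_left).aestronglyMeasurable.mul hf.1, ?_⟩
  rw [hasFiniteIntegral_iff_enorm]
  simpa only [enorm_mul] using (ENNReal.pow_lt_top_iff.1 hx).resolve_right two_ne_zero

theorem eLpNorm_integral_kernel_mul_le (hK : Measurable K.uncurry)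
    (hrow : ∀ᵐ x ∂μ, ∫⁻ y, ‖K x y‖ₑ ∂ν ≤ R) (hcol : ∀ᵐ y ∂ν, ∫⁻ x, ‖K x y‖ₑ ∂μ ≤ C)
    (hf : AEStronglyMeasurable f ν) :
    eLpNorm (fun x => ∫ y, K x y * f y ∂ν) 2 μ ≤ (R * C) ^ (1 / 2 : ℝ) * eLpNorm f 2 ν := by
  simp only [eLpNorm_eq_lintegral_rpow_enorm_toReal two_ne_zero ENNReal.ofNat_ne_top,
    ENNReal.toReal_ofNat, ENNReal.rpow_two]
  rw [← ENNReal.mul_rpow_of_nonneg _ _ (by positivity)]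
  gcongr
  refine (lintegral_mono fun x => ?_).trans
    (lintegral_sq_lintegral_kernel_mul_le (k := fun x y => ‖K x y‖ₑ) hK.enorm hrow hcol hf.enorm)
  gcongr
  exact (enorm_integral_le_lintegral_enorm _).trans_eq (by simp_rw [enorm_mul])

theorem memLp_integral_kernel_mul (hK : Measurable K.uncurry)
    (hrow : ∀ᵐ x ∂μ, ∫⁻ y, ‖K x y‖ₑ ∂ν ≤ R) (hcol : ∀ᵐ y ∂ν, ∫⁻ x, ‖K x y‖ₑ ∂μ ≤ C) (hR : R ≠ ∞)
    (hC : C ≠ ∞) (hf : MemLp f 2 ν) : MemLp (fun x => ∫ y, K x y * f y ∂ν) 2 μ :=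
  ⟨(hK.aestronglyMeasurable.mul hf.1.comp_snd).integral_prod_right',
    (eLpNorm_integral_kernel_mul_le hK hrow hcol hf.1).trans_lt (ENNReal.mul_lt_top
      (ENNReal.rpow_lt_top_of_nonneg (by positivity) (ENNReal.mul_ne_top hR hC)) hf.2)⟩

theorem exists_kernel_operator (hK : Measurable K.uncurry)
    (hrow : ∀ᵐ x ∂μ, ∫⁻ y, ‖K x y‖ₑ ∂ν ≤ R) (hcol : ∀ᵐ y ∂ν, ∫⁻ x, ‖K x y‖ₑ ∂μ ≤ C) (hR : R ≠ ∞)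
    (hC : C ≠ ∞) :
    ∃ T : Lp 𝕜 2 ν →L[𝕜] Lp 𝕜 2 μ, ∀ f : Lp 𝕜 2 ν, ∀ᵐ x ∂μ,
      Integrable (fun y => K x y * f y) ν ∧ T f x = ∫ y, K x y * f y ∂ν := by
  have hint (f : Lp 𝕜 2 ν) := ae_integrable_kernel_mul hK hrow hcol hR hC (Lp.memLp f)
  have hmem (f : Lp 𝕜 2 ν) := memLp_integral_kernel_mul hK hrow hcol hR hC (Lp.memLp f)
  let T₀ : Lp 𝕜 2 ν →ₗ[𝕜] Lp 𝕜 2 μ :=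
    { toFun := fun f => (hmem f).toLp _
      map_add' := fun f g => by
        rw [← MemLp.toLp_add]
        refine MemLp.toLp_congr _ _ ?_
        filter_upwards [hint f, hint g] with x hf hg
        rw [Pi.add_apply, ← integral_add hf hg]
        refine integral_congr_ae ?_
        filter_upwards [Lp.coeFn_add f g] with y hy
        rw [hy, Pi.add_apply, mul_add]
      map_smul' := fun c f => by
        rw [RingHom.id_apply, ← MemLp.toLp_const_smul]
        refine MemLp.toLp_congr _ _ (Eventually.of_forall fun x => ?_)
        rw [Pi.smul_apply, smul_eq_mul, ← integral_const_mul]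
        refine integral_congr_ae ?_
        filter_upwards [Lp.coeFn_smul c f] with y hy
        rw [hy, Pi.smul_apply, smul_eq_mul, mul_left_comm] }
  refine ⟨T₀.mkContinuous ((R * C) ^ (1 / 2 : ℝ)).toReal fun f => ?_, fun f => ?_⟩
  · change ‖(hmem f).toLp _‖ ≤ _
    rw [Lp.norm_toLp, Lp.norm_def, ← ENNReal.toReal_mul]
    exact ENNReal.toReal_mono (ENNReal.mul_ne_top (ENNReal.rpow_ne_top_of_nonneg (by positivity)
      (ENNReal.mul_ne_top hR hC)) (Lp.memLp f).2.ne)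
      (eLpNorm_integral_kernel_mul_le hK hrow hcol (Lp.memLp f).1)
  · filter_upwards [hint f, (hmem f).coeFn_toLp] with x hx hx'
    exact ⟨hx, hx'⟩

theorem integrable_prod_kernel_mul_mul (hK : Measurable K.uncurry)
    (hrow : ∀ᵐ x ∂μ, ∫⁻ y, ‖K x y‖ₑ ∂ν ≤ R) (hcol : ∀ᵐ y ∂ν, ∫⁻ x, ‖K x y‖ₑ ∂μ ≤ C) (hR : R ≠ ∞)
    (hC : C ≠ ∞) {g : X → 𝕜} (hf : MemLp f 2 ν) (hg : MemLp g 2 μ) :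
    Integrable (fun p : X × Y => K p.1 p.2 * (g p.1 * f p.2)) (μ.prod ν) := by
  have hint1 : Integrable (fun p : X × Y => ‖K p.1 p.2‖ * ‖f p.2‖ ^ 2) (μ.prod ν) :=
    integrable_prod_kernel_mul (K := fun x y => ‖K x y‖) hK.norm (by simpa using hcol) hC
      hf.norm.integrable_sq
  have hint2 : Integrable (fun p : X × Y => ‖K p.1 p.2‖ * ‖g p.1‖ ^ 2) (μ.prod ν) :=
    (integrable_prod_kernel_mul (μ := ν) (ν := μ) (K := fun y x => ‖K x y‖)
      (hK.comp measurable_swap).norm (by simpa using hrow) hR hg.norm.integrable_sq).swap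
  refine (hint1.add hint2).mono'
    (hK.aestronglyMeasurable.mul (hg.1.comp_fst.mul hf.1.comp_snd))
    (Eventually.of_forall fun p => ?_)
  rw [norm_mul, norm_mul, Pi.add_apply, ← mul_add]
  gcongr
  nlinarith [sq_nonneg (‖g p.1‖ - ‖f p.2‖), sq_nonneg (‖g p.1‖), sq_nonneg (‖f p.2‖)]

end SchurTest

section PosSemidefKernel

variable {X Z : Type*} [MeasurableSpace X] [MeasurableSpace Z] {ν : Measure X} {K : X → X → ℝ}

/-- Positive semidefiniteness of the quadratic form of the real kernel `K` on functions of the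
measure space `(X, ν)`. It is tested on all measurable `f` for which the form converges
absolutely, so that no boundedness of the integral operator has to be presupposed. -/
def IsPosSemidefKernel (K : X → X → ℝ) (ν : Measure X) : Prop :=
  ∀ f : X → ℝ, AEStronglyMeasurable f ν →
    Integrable (fun p : X × X => K p.1 p.2 * (f p.1 * f p.2)) (ν.prod ν) →
      0 ≤ ∫ p, K p.1 p.2 * (f p.1 * f p.2) ∂ν.prod ν

theorem isPosSemidefKernel_mul_self [SFinite ν] (g : X → ℝ) :
    IsPosSemidefKernel (fun x y => g x * g y) ν := by
  intro f _ _
  have hsplit : ∫ p : X × X, g p.1 * g p.2 * (f p.1 * f p.2) ∂ν.prod ν =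
      (∫ x, g x * f x ∂ν) * ∫ x, g x * f x ∂ν := by
    rw [← integral_prod_mul]
    exact integral_congr_ae (.of_forall fun p => mul_mul_mul_comm _ _ _ _)
  exact hsplit ▸ mul_self_nonneg _

theorem IsPosSemidefKernel.const_mul (hK : IsPosSemidefKernel K ν) {c : ℝ} (hc : 0 ≤ c) :
    IsPosSemidefKernel (fun x y => c * K x y) ν := by
  intro f hf hint
  rcases hc.eq_or_lt with rfl | hc
  · simp
  simp only [mul_assoc c] at hint ⊢
  rw [integral_const_mul]
  exact mul_nonneg hc.le (hK f hf ((integrable_const_mul_iff hc.ne'.isUnit _).1 hint))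

theorem IsPosSemidefKernel.superposition [SFinite ν] {ρ : Measure Z} [SFinite ρ]
    {κ : Z → X → X → ℝ} (hκ : ∀ᵐ z ∂ρ, IsPosSemidefKernel (κ z) ν)
    (hmeas : Measurable fun q : (X × X) × Z => κ q.2 q.1.1 q.1.2)
    (hnonneg : ∀ᵐ z ∂ρ, ∀ x y, 0 ≤ κ z x y)
    (hint : ∀ᵐ p ∂ν.prod ν, Integrable (fun z => κ z p.1 p.2) ρ)
    (hK : ∀ᵐ p ∂ν.prod ν, ∫ z, κ z p.1 p.2 ∂ρ = K p.1 p.2) : IsPosSemidefKernel K ν := by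
  intro f hf hKf
  have hff : AEStronglyMeasurable (fun p : X × X => f p.1 * f p.2) (ν.prod ν) :=
    hf.comp_fst.mul hf.comp_snd
  have hprod : Integrable (fun q : (X × X) × Z => κ q.2 q.1.1 q.1.2 * (f q.1.1 * f q.1.2))
      ((ν.prod ν).prod ρ) := by
    refine (integrable_prod_iff (by exact hmeas.aestronglyMeasurable.mul hff.comp_fst)).2
      ⟨?_, ?_⟩
    · filter_upwards [hint] with p hp using hp.mul_const _
    · refine hKf.norm.congr ?_
      filter_upwards [hK] with p hp
      have habs : ∀ᵐ z ∂ρ, ‖κ z p.1 p.2 * (f p.1 * f p.2)‖ = κ z p.1 p.2 * ‖f p.1 * f p.2‖ := by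
        filter_upwards [hnonneg] with z hz
        rw [norm_mul, Real.norm_of_nonneg (hz _ _)]
      rw [integral_congr_ae habs, integral_mul_const, hp, norm_mul, Real.norm_of_nonneg]
      exact hp ▸ integral_nonneg_of_ae (hnonneg.mono fun z hz => hz _ _)
  have hswap : ∫ p, K p.1 p.2 * (f p.1 * f p.2) ∂ν.prod ν =
      ∫ z, ∫ p : X × X, κ z p.1 p.2 * (f p.1 * f p.2) ∂ν.prod ν ∂ρ := by
    rw [← integral_integral_swap hprod]
    refine integral_congr_ae ?_
    filter_upwards [hK] with p hp
    rw [integral_mul_const, hp]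
  rw [hswap]
  refine integral_nonneg_of_ae ?_
  filter_upwards [hκ, hprod.prod_left_ae] with z hz hzint using hz f hf hzint

theorem IsPosSemidefKernel.inner_nonneg [SFinite ν] (hK : IsPosSemidefKernel K ν)
    {f g : Lp ℝ 2 ν}
    (hint : Integrable (fun p : X × X => K p.1 p.2 * (f p.1 * f p.2)) (ν.prod ν))
    (hg : ∀ᵐ x ∂ν, g x = ∫ y, K x y * f y ∂ν) : 0 ≤ inner ℝ g f := by
  have hform : inner ℝ g f = ∫ p, K p.1 p.2 * (f p.1 * f p.2) ∂ν.prod ν := by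
    rw [L2.inner_def, integral_prod _ hint]
    refine integral_congr_ae ?_
    filter_upwards [hg] with x hx
    simp only [RCLike.inner_apply, conj_trivial, hx, ← integral_const_mul, mul_left_comm (f x)]
  exact hform ▸ hK f (Lp.aestronglyMeasurable f) hint

theorem ae_prod_fst_ne_snd [MeasurableEq X] [SFinite ν]
    [NullSingletonClass ν] : ∀ᵐ p ∂ν.prod ν, p.1 ≠ p.2 := by
  refine (Measure.ae_prod_iff_ae_ae measurableSet_diagonal.compl).2 (.of_forall fun x => ?_)
  filter_upwards [measure_eq_zero_iff_ae_notMem.1 (measure_singleton (μ := ν) x)] with y hy hxy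
  exact hy (mem_singleton_iff.2 hxy.symm)

end PosSemidefKernel

section RieszKernel

variable {V : Type*} [NormedAddCommGroup V] [InnerProductSpace ℝ V]

theorem exp_neg_mul_exp_neg_sq_dist (x y w : V) (t : ℝ) :
    Real.exp (-(2 * t) * ‖x - w‖ ^ 2) * Real.exp (-(2 * t) * ‖y - w‖ ^ 2) =
      Real.exp (-t * ‖x - y‖ ^ 2) * Real.exp (-(4 * t) * ‖w - midpoint ℝ x y‖ ^ 2) := by
  rw [← Real.exp_add, ← Real.exp_add]
  congr 1
  have h := parallelogram_law_with_norm ℝ (x - w) (y - w)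
  have hadd : x - w + (y - w) = (-2 : ℝ) • (w - midpoint ℝ x y) := by
    rw [midpoint_eq_smul_add, invOf_eq_inv]; module
  rw [hadd, sub_sub_sub_cancel_right, norm_smul, Real.norm_eq_abs, abs_neg, abs_two] at h
  linear_combination t * h

variable [FiniteDimensional ℝ V] [MeasurableSpace V] [BorelSpace V] {ν : Measure V} [SFinite ν]

theorem integrable_exp_neg_mul_sq_norm {t : ℝ} (ht : 0 < t) :
    Integrable fun w : V => Real.exp (-t * ‖w‖ ^ 2) :=
  .of_integral_ne_zero <| by
    rw [GaussianFourier.integral_rexp_neg_mul_sq_norm ht]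
    positivity

theorem isPosSemidefKernel_gaussian {t : ℝ} (ht : 0 < t) :
    IsPosSemidefKernel (fun x y : V => Real.exp (-t * ‖x - y‖ ^ 2)) ν := by
  have ht4 : 0 < 4 * t := by positivity
  set J : ℝ := ∫ w : V, Real.exp (-(4 * t) * ‖w‖ ^ 2) with hJ
  have hJ0 : 0 < J := by
    rw [hJ, GaussianFourier.integral_rexp_neg_mul_sq_norm ht4]
    positivity
  refine .superposition (ρ := volume) (κ := fun w x y => J⁻¹ *
    (Real.exp (-(2 * t) * ‖x - w‖ ^ 2) * Real.exp (-(2 * t) * ‖y - w‖ ^ 2)))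
    (.of_forall fun w => (isPosSemidefKernel_mul_self _).const_mul (inv_nonneg.2 hJ0.le))
    (by fun_prop) (.of_forall fun w x y => by positivity) (.of_forall fun p => ?_)
    (.of_forall fun p => ?_) <;> simp only [exp_neg_mul_exp_neg_sq_dist]
  · exact (((integrable_exp_neg_mul_sq_norm ht4).comp_sub_right _).const_mul _).const_mul _
  · rw [integral_const_mul, integral_const_mul,
      integral_sub_right_eq_self fun w : V => Real.exp (-(4 * t) * ‖w‖ ^ 2), ← hJ,
      mul_left_comm, inv_mul_cancel₀ hJ0.ne', mul_one]

theorem isPosSemidefKernel_norm_rpow [NullSingletonClass ν] {s : ℝ} (hs : 0 < s) :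
    IsPosSemidefKernel (fun x y : V => ‖x - y‖ ^ (-s)) ν := by
  have hΓ : 0 < Real.Gamma (s / 2) := Real.Gamma_pos_of_pos (half_pos hs)
  have hval {x y : V} (hxy : x ≠ y) :
      ∫ t in Ioi (0 : ℝ), t ^ (s / 2 - 1) * Real.exp (-t * ‖x - y‖ ^ 2) =
        Real.Gamma (s / 2) * ‖x - y‖ ^ (-s) := by
    have hr : 0 < ‖x - y‖ := norm_sub_pos_iff.2 hxy
    have h := Real.integral_rpow_mul_exp_neg_mul_Ioi (half_pos hs) (pow_pos hr 2)
    simp_rw [neg_mul, mul_comm _ (‖x - y‖ ^ 2)]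
    rw [h, mul_comm, one_div, ← Real.rpow_natCast, ← Real.rpow_neg hr.le, ← Real.rpow_mul hr.le]
    congr 2
    push_cast
    ring
  refine .superposition (ρ := volume.restrict (Ioi 0)) (κ := fun t x y => (Real.Gamma (s / 2))⁻¹ *
    (t ^ (s / 2 - 1) * Real.exp (-t * ‖x - y‖ ^ 2))) ?_ (by fun_prop) ?_ ?_ ?_
  · filter_upwards [self_mem_ae_restrict measurableSet_Ioi] with t (ht : 0 < t)
    exact ((isPosSemidefKernel_gaussian ht).const_mul (Real.rpow_nonneg ht.le _)).const_mul
      (inv_nonneg.2 hΓ.le)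
  · filter_upwards [self_mem_ae_restrict measurableSet_Ioi] with t (ht : 0 < t) x y
    positivity
  · filter_upwards [ae_prod_fst_ne_snd] with p hp
    refine (Integrable.of_integral_ne_zero ?_).const_mul _
    have hr : 0 < ‖p.1 - p.2‖ := norm_sub_pos_iff.2 hp
    rw [hval hp]
    positivity
  · filter_upwards [ae_prod_fst_ne_snd] with p hp
    rw [integral_const_mul, hval hp, inv_mul_cancel_left₀ hΓ.ne']

end RieszKernel

section PolarCoordinates

open Module (finrank)

variable {E F : Type*} [NormedAddCommGroup E] [NormedSpace ℝ E] [NormedAddCommGroup F]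
  [NormedSpace ℝ F]

theorem integral_volumeIoiPow (n : ℕ) (f : ℝ → F) :
    ∫ r, f r ∂(Measure.volumeIoiPow n) = ∫ r in Ioi (0 : ℝ), r ^ n • f r := by
  simp only [Measure.volumeIoiPow, ENNReal.ofReal]
  rw [integral_withDensity_eq_integral_smul (measurable_subtype_coe.pow_const _).real_toNNReal,
    integral_subtype_comap measurableSet_Ioi fun r : ℝ => Real.toNNReal (r ^ n) • f r]
  refine setIntegral_congr_fun measurableSet_Ioi fun r hr => ?_
  simp only [NNReal.smul_def, Real.coe_toNNReal _ (pow_nonneg (le_of_lt hr) n)]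

theorem integral_Ioi_fderiv_sub_smul [CompleteSpace F] {g : E → F} (hg : ContDiff ℝ 1 g)
    (hgc : HasCompactSupport g) (x : E) {v : E} (hv : v ≠ 0) :
    ∫ r in Ioi (0 : ℝ), fderiv ℝ g (x - r • v) v = g x := by
  have hderiv (r : ℝ) : HasDerivAt (fun r : ℝ => g (x - r • v)) (-fderiv ℝ g (x - r • v) v) r := by
    have hline : HasDerivAt (fun r : ℝ => x - r • v) (-v) r := by
      simpa using ((hasDerivAt_id r).smul_const v).const_sub x
    rw [← map_neg]
    exact (hg.differentiable one_ne_zero (x - r • v)).hasFDerivAt.comp_hasDerivAt r hline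
  have hsupp : HasCompactSupport fun r : ℝ => g (x - r • v) :=
    hgc.comp_isClosedEmbedding
      ((Homeomorph.subLeft x).isClosedEmbedding.comp (isClosedEmbedding_smul_left hv))
  have hftc := hsupp.integral_Ioi_deriv_eq (hg.comp (by fun_prop)) 0
  rw [Function.comp_def, deriv_eq hderiv, integral_neg, neg_inj] at hftc
  simpa only [zero_smul, sub_zero] using hftc

variable [FiniteDimensional ℝ E] [MeasurableSpace E] [BorelSpace E] {μ : Measure E}
  [μ.IsAddHaarMeasure]

theorem integral_eq_integral_toSphere [Nontrivial E] {f : E → F} (hf : Integrable f μ) :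
    ∫ z, f z ∂μ = ∫ θ : sphere (0 : E) 1,
      (∫ r in Ioi (0 : ℝ), r ^ (finrank ℝ E - 1) • f (r • (θ : E))) ∂μ.toSphere := by
  have hpolar := μ.measurePreserving_homeomorphUnitSphereProd
  have hemb := (homeomorphUnitSphereProd E).measurableEmbedding
  let f' : sphere (0 : E) 1 × Ioi (0 : ℝ) → F := fun p => f ((p.2 : ℝ) • (p.1 : E))
  have hf' : f' ∘ homeomorphUnitSphereProd E = f ∘ Subtype.val := by
    ext x
    have hx := congr_arg Subtype.val ((homeomorphUnitSphereProd E).symm_apply_apply x)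
    rw [homeomorphUnitSphereProd_symm_apply_coe] at hx
    simp only [f', Function.comp_apply, hx]
  have hf'int : Integrable f' (μ.toSphere.prod (.volumeIoiPow (finrank ℝ E - 1))) := by
    rw [← hpolar.integrable_comp_emb hemb, hf']
    exact (integrableOn_iff_comap_subtypeVal (measurableSet_singleton _).compl).1 hf.integrableOn
  calc ∫ z, f z ∂μ = ∫ x : ({0}ᶜ : Set E), (f ∘ Subtype.val) x ∂(μ.comap Subtype.val) := by
        simp_rw [Function.comp_apply]
        rw [integral_subtype_comap (measurableSet_singleton _).compl f, restrict_compl_singleton]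
    _ = ∫ p, f' p ∂μ.toSphere.prod (.volumeIoiPow (finrank ℝ E - 1)) := by
        rw [← hpolar.integral_comp hemb, ← hf']
        rfl
    _ = _ := by
        rw [integral_prod _ hf'int]
        exact integral_congr_ae (Eventually.of_forall fun θ =>
          integral_volumeIoiPow _ fun r => f (r • (θ : E)))

theorem locallyIntegrable_norm_pow_inv {n : ℕ} (hn : n < finrank ℝ E) :
    LocallyIntegrable (fun z : E => (‖z‖ ^ n)⁻¹) μ := by
  refine locallyIntegrable_of_norm_le_rpow (C := 1) (α := n) (by lia) (by exact_mod_cast hn)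
    (Eventually.of_forall fun z => ?_) (by fun_prop)
  rw [norm_inv, norm_pow, norm_norm, one_mul, Real.rpow_neg (norm_nonneg z), Real.rpow_natCast]

theorem locallyIntegrable_norm_pow_inv_smul [Nontrivial E] :
    LocallyIntegrable (fun z : E => (‖z‖ ^ finrank ℝ E)⁻¹ • z) μ := by
  have hE : 0 < finrank ℝ E := Module.finrank_pos
  refine (locallyIntegrable_norm_pow_inv (Nat.sub_lt hE one_pos)).mono (by fun_prop)
    (Eventually.of_forall fun z => ?_)
  rw [norm_smul, norm_inv, norm_inv, norm_pow, norm_pow, norm_norm, ← pow_sub_one_mul hE.ne',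
    mul_inv, mul_assoc]
  exact mul_le_of_le_one_right (by positivity)
    (inv_mul_le_one_of_le₀ le_rfl (norm_nonneg z))

theorem convolution_norm_pow_inv_smul_fderiv [Nontrivial E] [CompleteSpace F] {g : E → F}
    (hg : ContDiff ℝ 1 g) (hgc : HasCompactSupport g) (x : E) :
    ((fun z : E => (‖z‖ ^ finrank ℝ E)⁻¹ • z) ⋆[ContinuousLinearMap.apply ℝ F, μ]
      fderiv ℝ g) x = (finrank ℝ E * μ.real (ball 0 1)) • g x := by
  have hdg := hg.continuous_fderiv one_ne_zero
  obtain ⟨B, hB⟩ := (hgc.fderiv ℝ).exists_bound_of_continuous hdg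
  have hint := convolutionExists_of_bounded (μ := μ) (ContinuousLinearMap.apply ℝ F)
    locallyIntegrable_norm_pow_inv_smul hdg.aestronglyMeasurable hB (hgc.fderiv ℝ) x
  rw [convolution_def, integral_eq_integral_toSphere hint]
  have hray (θ : sphere (0 : E) 1) : ∫ r in Ioi (0 : ℝ), r ^ (finrank ℝ E - 1) •
      ContinuousLinearMap.apply ℝ F ((‖r • (θ : E)‖ ^ finrank ℝ E)⁻¹ • r • (θ : E))
        (fderiv ℝ g (x - r • (θ : E))) = g x := by
    rw [← integral_Ioi_fderiv_sub_smul hg hgc x (v := θ) (ne_zero_of_mem_unit_sphere θ)]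
    refine setIntegral_congr_fun measurableSet_Ioi fun r (hr : 0 < r) => ?_
    have hpow : r ^ (finrank ℝ E - 1) * ((r ^ finrank ℝ E)⁻¹ * r) = 1 := by
      rw [← pow_sub_one_mul (Module.finrank_pos (R := ℝ) (M := E)).ne' r]
      field_simp
    rw [ContinuousLinearMap.apply_apply, norm_smul, norm_eq_of_mem_sphere, mul_one,
      Real.norm_of_nonneg hr.le, smul_smul, map_smul, smul_smul, hpow, one_smul]
  simp only [hray, integral_const, Measure.toSphere_real_apply_univ]

end PolarCoordinates

section Laplacian

variable {V : Type*} [NormedAddCommGroup V] [InnerProductSpace ℝ V]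
  {F F' G : Type*} [NormedAddCommGroup F] [NormedSpace ℝ F] [NormedAddCommGroup F']
  [NormedSpace ℝ F'] [NormedAddCommGroup G] [NormedSpace ℝ G]

theorem contDiff_two_of_hasFDerivAt {f : V → F} {f' : V → V →L[ℝ] F} {f'' : V → V →L[ℝ] V →L[ℝ] F}
    (hf : ∀ x, HasFDerivAt f (f' x) x) (hf' : ∀ x, HasFDerivAt f' (f'' x) x)
    (hf'' : Continuous f'') : ContDiff ℝ 2 f :=
  contDiff_succ_iff_hasFDerivAt (n := 1).2
    ⟨f', contDiff_one_iff_hasFDerivAt.2 ⟨f'', hf'', hf'⟩, hf⟩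

variable [FiniteDimensional ℝ V]

theorem laplacian_eq_sum_of_hasFDerivAt {ι : Type*} [Fintype ι] (b : OrthonormalBasis ι ℝ V)
    {f : V → F} {f' : V → V →L[ℝ] F} {f'' : V →L[ℝ] V →L[ℝ] F} {x : V}
    (hf : ∀ᶠ y in 𝓝 x, HasFDerivAt f (f' y) y) (hf' : HasFDerivAt f' f'' x) :
    (Δ f) x = ∑ i, f'' (b i) (b i) := by
  have hfderiv : fderiv ℝ f =ᶠ[𝓝 x] f' := hf.mono fun y hy => hy.fderiv
  simp only [InnerProductSpace.laplacian_eq_iteratedFDeriv_orthonormalBasis f b,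
    iteratedFDeriv_two_apply, hfderiv.fderiv_eq, hf'.fderiv, Matrix.cons_val_zero,
    Matrix.cons_val_one]

variable [MeasurableSpace V] [BorelSpace V] {μ : Measure V} [μ.IsAddHaarMeasure]
  [CompleteSpace G] {k : V → F} {f : V → F'} {B : ℝ}

theorem hasFDerivAt_convolution_of_contDiff (L : F →L[ℝ] F' →L[ℝ] G)
    (hV : 2 ≤ Module.finrank ℝ V) (hk : ContDiff ℝ 1 k) (hf : AEStronglyMeasurable f μ)
    (hB : ∀ y, ‖f y‖ ≤ B) (hfc : HasCompactSupport f) (x : V) :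
    HasFDerivAt (k ⋆[L, μ] f) ((fderiv ℝ k ⋆[L.precompL V, μ] f) x) x :=
  hasFDerivAt_convolution_of_contDiffOn_compl L hV hk.continuous.locallyIntegrable
    hk.contDiffOn (hk.continuous_fderiv one_ne_zero).locallyIntegrable hf hB hfc x

theorem contDiff_two_convolution_left (L : F →L[ℝ] F' →L[ℝ] G) (hV : 2 ≤ Module.finrank ℝ V)
    (hk : ContDiff ℝ 2 k) (hf : AEStronglyMeasurable f μ) (hB : ∀ y, ‖f y‖ ≤ B)
    (hfc : HasCompactSupport f) : ContDiff ℝ 2 (k ⋆[L, μ] f) := by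
  have hk' : ContDiff ℝ 1 (fderiv ℝ k) := hk.fderiv_right (by norm_num)
  exact contDiff_two_of_hasFDerivAt
    (hasFDerivAt_convolution_of_contDiff L hV (hk.of_le one_le_two) hf hB hfc)
    (hasFDerivAt_convolution_of_contDiff (L.precompL V) hV hk' hf hB hfc)
    (continuous_convolution_of_bounded _ (hk'.continuous_fderiv one_ne_zero).locallyIntegrable
      hf hB hfc)

theorem laplacian_convolution_left (L : F →L[ℝ] F' →L[ℝ] G) (hV : 2 ≤ Module.finrank ℝ V)
    (hk : ContDiff ℝ 2 k) (hf : AEStronglyMeasurable f μ) (hB : ∀ y, ‖f y‖ ≤ B)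
    (hfc : HasCompactSupport f) (x : V) : (Δ (k ⋆[L, μ] f)) x = (Δ k ⋆[L, μ] f) x := by
  have hk' : ContDiff ℝ 1 (fderiv ℝ k) := hk.fderiv_right (by norm_num)
  have hk'' := (hk'.continuous_fderiv one_ne_zero).locallyIntegrable (μ := μ)
  have hconv := convolutionExists_of_bounded (G := V →L[ℝ] V →L[ℝ] G)
    ((L.precompL V).precompL V) hk'' hf hB hfc x
  let b := stdOrthonormalBasis ℝ V
  rw [laplacian_eq_sum_of_hasFDerivAt b (Eventually.of_forall
    (hasFDerivAt_convolution_of_contDiff L hV (hk.of_le one_le_two) hf hB hfc))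
    (hasFDerivAt_convolution_of_contDiff (L.precompL V) hV hk' hf hB hfc x)]
  have hsum (t : V) : L ((Δ k) t) (f (x - t)) =
      ∑ i, (L.precompL V).precompL V (fderiv ℝ (fderiv ℝ k) t) (f (x - t)) (b i) (b i) := by
    rw [InnerProductSpace.laplacian_eq_iteratedFDeriv_orthonormalBasis k b]
    simp [iteratedFDeriv_two_apply]
  simp_rw [convolution_def, hsum, ContinuousLinearMap.integral_apply hconv,
    ContinuousLinearMap.integral_apply (hconv.apply_continuousLinearMap _)]
  exact (integral_finsetSum _ fun i _ => (hconv.apply_continuousLinearMap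
    (b i)).apply_continuousLinearMap (b i)).symm

theorem contDiff_two_convolution_right (L : F →L[ℝ] F' →L[ℝ] G) (hV : 2 ≤ Module.finrank ℝ V)
    (hk : LocallyIntegrable k μ) (hkd : ContDiffOn ℝ 1 k {0}ᶜ)
    (hdk : LocallyIntegrable (fderiv ℝ k) μ) (hf : ContDiff ℝ 1 f) (hfc : HasCompactSupport f) :
    ContDiff ℝ 2 (k ⋆[L, μ] f) := by
  obtain ⟨B, hB⟩ := hfc.exists_bound_of_continuous hf.continuous
  have hdf := hf.continuous_fderiv one_ne_zero
  obtain ⟨B', hB'⟩ := (hfc.fderiv ℝ).exists_bound_of_continuous hdf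
  exact contDiff_two_of_hasFDerivAt
    (hasFDerivAt_convolution_of_contDiffOn_compl L hV hk hkd hdk hf.continuous.aestronglyMeasurable
      hB hfc)
    (hfc.hasFDerivAt_convolution_right (L.precompL V) hdk hf)
    (continuous_convolution_of_bounded _ hdk hdf.aestronglyMeasurable hB' (hfc.fderiv ℝ))

theorem laplacian_convolution_right {ι : Type*} [Fintype ι] (b : OrthonormalBasis ι ℝ V)
    (L : F →L[ℝ] F' →L[ℝ] G) (hV : 2 ≤ Module.finrank ℝ V) (hk : LocallyIntegrable k μ)
    (hkd : ContDiffOn ℝ 1 k {0}ᶜ) (hdk : LocallyIntegrable (fderiv ℝ k) μ) (hf : ContDiff ℝ 1 f)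
    (hfc : HasCompactSupport f) (x : V) :
    (Δ (k ⋆[L, μ] f)) x =
      ∫ t, ∑ i, L (fderiv ℝ k t (b i)) (fderiv ℝ f (x - t) (b i)) ∂μ := by
  obtain ⟨B, hB⟩ := hfc.exists_bound_of_continuous hf.continuous
  have hdf := hf.continuous_fderiv one_ne_zero
  obtain ⟨B', hB'⟩ := (hfc.fderiv ℝ).exists_bound_of_continuous hdf
  have hconv := convolutionExists_of_bounded (G := V →L[ℝ] V →L[ℝ] G)
    ((L.precompL V).precompR V) hdk hdf.aestronglyMeasurable hB' (hfc.fderiv ℝ) x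
  rw [laplacian_eq_sum_of_hasFDerivAt b
    (Eventually.of_forall (hasFDerivAt_convolution_of_contDiffOn_compl L hV hk hkd hdk
      hf.continuous.aestronglyMeasurable hB hfc))
    (hfc.hasFDerivAt_convolution_right (L.precompL V) hdk hf x)]
  simp_rw [convolution_def, ContinuousLinearMap.integral_apply hconv,
    ContinuousLinearMap.integral_apply (hconv.apply_continuousLinearMap _)]
  exact (integral_finsetSum _ fun i _ => (hconv.apply_continuousLinearMap
    (b i)).apply_continuousLinearMap (b i)).symm

end Laplacian

section NormPow

variable {V : Type*} [NormedAddCommGroup V] [InnerProductSpace ℝ V]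

theorem contDiffAt_norm_pow_inv (n : ℕ) {k : WithTop ℕ∞} {z : V} (hz : z ≠ 0) :
    ContDiffAt ℝ k (fun z : V => (‖z‖ ^ n)⁻¹) z :=
  ((contDiffAt_norm ℝ hz).pow n).inv (pow_ne_zero n (norm_ne_zero_iff.2 hz))

theorem hasFDerivAt_norm_pow_inv (n : ℕ) {z : V} (hz : z ≠ 0) :
    HasFDerivAt (fun z : V => (‖z‖ ^ n)⁻¹) (-(n * (‖z‖ ^ (n + 2))⁻¹) • innerSL ℝ z) z := by
  have hz0 : ‖z‖ ≠ 0 := norm_ne_zero_iff.2 hz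
  have hrpow (z : V) : (‖z‖ ^ n)⁻¹ = (‖z‖ ^ 2) ^ (-(n : ℝ) / 2) := by
    rw [← Real.rpow_natCast_mul (norm_nonneg z), Nat.cast_ofNat, mul_div_cancel₀ _ two_ne_zero,
      Real.rpow_neg (norm_nonneg z), Real.rpow_natCast]
  simp_rw [hrpow]
  convert! (hasStrictFDerivAt_norm_sq z).hasFDerivAt.rpow_const (p := -(n : ℝ) / 2)
    (.inl (by positivity)) using 1
  rw [Real.rpow_sub_one (by positivity), ← hrpow, ← Nat.cast_smul_eq_nsmul ℝ, smul_smul, pow_add]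
  congr 1
  push_cast
  field_simp

variable [FiniteDimensional ℝ V]

theorem laplacian_norm_pow_inv (n : ℕ) {z : V} (hz : z ≠ 0) :
    (Δ fun z : V => (‖z‖ ^ n)⁻¹) z =
      n * (n + 2 - Module.finrank ℝ V) * (‖z‖ ^ (n + 2))⁻¹ := by
  have hz0 : ‖z‖ ≠ 0 := norm_ne_zero_iff.2 hz
  have hgrad : HasFDerivAt (fun y : V => -(n * (‖y‖ ^ (n + 2))⁻¹) • innerSL ℝ y) _ z :=
    (((hasFDerivAt_norm_pow_inv (n + 2) hz).const_mul (n : ℝ)).neg).smul (innerSL ℝ).hasFDerivAt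
  have hnear : ∀ᶠ y in 𝓝 z, HasFDerivAt (fun z : V => (‖z‖ ^ n)⁻¹)
      (-(n * (‖y‖ ^ (n + 2))⁻¹) • innerSL ℝ y) y :=
    (isOpen_ne.eventually_mem hz).mono fun y hy => hasFDerivAt_norm_pow_inv n hy
  let b := stdOrthonormalBasis ℝ V
  calc (Δ fun z : V => (‖z‖ ^ n)⁻¹) z
      = ∑ i, (n * (n + 2) * (‖z‖ ^ (n + 2 + 2))⁻¹ * ‖inner ℝ z (b i)‖ ^ 2 -
          n * (‖z‖ ^ (n + 2))⁻¹) := by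
        rw [laplacian_eq_sum_of_hasFDerivAt b hnear hgrad]
        refine Finset.sum_congr rfl fun i _ => ?_
        have hdiag : (innerSL ℝ : V →L[ℝ] V →L[ℝ] ℝ) (b i) (b i) = 1 := b.inner_eq_one i
        simp only [Pi.neg_apply, neg_smul, Nat.cast_add, Nat.cast_ofNat, smul_neg, neg_neg,
          add_apply, neg_apply, smul_apply, ContinuousLinearMap.smulRight_apply, coe_innerSL_apply,
          smul_eq_mul, hdiag, Real.norm_eq_abs, sq_abs]
        ring
    _ = n * (n + 2) * (‖z‖ ^ (n + 2 + 2))⁻¹ * ‖z‖ ^ 2 -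
          Module.finrank ℝ V * (n * (‖z‖ ^ (n + 2))⁻¹) := by
        rw [Finset.sum_sub_distrib, ← Finset.mul_sum, b.sum_sq_norm_inner_left, Finset.sum_const,
          Finset.card_univ, Fintype.card_fin, nsmul_eq_mul]
    _ = _ := by
        rw [pow_add _ _ 2]
        field_simp

end NormPow

section Localization

variable {E F F' G : Type*} [NormedAddCommGroup E] [NormedSpace ℝ E] [HasContDiffBump E]
  [NormedAddCommGroup F] [NormedSpace ℝ F] {k : E → F} {n : ℕ}

theorem exists_contDiff_eqOn_compl_ball (hk : ContDiffOn ℝ n k {0}ᶜ) {ε : ℝ} (hε : 0 < ε) :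
    ∃ k' : E → F, ContDiff ℝ n k' ∧ EqOn k' k (ball 0 ε)ᶜ := by
  let χ : ContDiffBump (0 : E) := ⟨ε / 2, ε, by positivity, by linarith⟩
  refine ⟨fun z => (1 - χ z) • k z, contDiff_iff_contDiffAt.2 fun z => ?_, fun z hz => ?_⟩
  · rcases eq_or_ne z 0 with rfl | hz
    · refine (contDiffAt_const (c := (0 : F))).congr_of_eventuallyEq ?_
      filter_upwards [χ.eventuallyEq_one] with z hz
      rw [hz, Pi.one_apply, sub_self, zero_smul]
    · exact (contDiffAt_const.sub χ.contDiffAt).smul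
        (hk.contDiffAt (isOpen_compl_singleton.mem_nhds hz))
  · dsimp only
    rw [χ.zero_of_le_dist (by simpa using hz), sub_zero, one_smul]

theorem exists_contDiff_hasCompactSupport_eventuallyEq [FiniteDimensional ℝ E] {x : E}
    (hk : ContDiffAt ℝ n k x) :
    ∃ g : E → F, ContDiff ℝ n g ∧ HasCompactSupport g ∧ g =ᶠ[𝓝 x] k := by
  obtain ⟨r, hr, hball⟩ := eventually_nhds_iff_ball.1 (hk.eventually (by simp))
  let χ : ContDiffBump x := ⟨r / 4, r / 2, by positivity, by linarith⟩
  refine ⟨fun y => χ y • k y, contDiff_iff_contDiffAt.2 fun y => ?_,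
    χ.hasCompactSupport.smul_right, ?_⟩
  · by_cases hy : y ∈ ball x r
    · exact χ.contDiffAt.smul (hball y hy)
    · have hyχ : y ∉ tsupport χ := fun h => by
        rw [χ.tsupport_eq, mem_closedBall] at h
        rw [mem_ball, not_lt] at hy
        linarith [show χ.rOut = r / 2 from rfl]
      refine (contDiffAt_const (c := (0 : F))).congr_of_eventuallyEq ?_
      filter_upwards [notMem_tsupport_iff_eventuallyEq.1 hyχ] with z hz
      rw [hz, Pi.zero_apply, zero_smul]
  · filter_upwards [χ.eventuallyEq_one] with y hy
    rw [hy, Pi.one_apply, one_smul]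

variable [NormedAddCommGroup F'] [NormedSpace ℝ F'] [NormedAddCommGroup G] [NormedSpace ℝ G]
  [MeasurableSpace E] {μ : Measure E} {f : E → F'} {x : E}

theorem exists_contDiff_convolution_eventuallyEq (L : F →L[ℝ] F' →L[ℝ] G)
    (hk : ContDiffOn ℝ n k {0}ᶜ) (hx : x ∉ tsupport f) :
    ∃ k' : E → F, ContDiff ℝ n k' ∧ k ⋆[L, μ] f =ᶠ[𝓝 x] k' ⋆[L, μ] f ∧
      ∀ t, f (x - t) ≠ 0 → t ≠ 0 ∧ k' =ᶠ[𝓝 t] k := by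
  obtain ⟨r, hr, hball⟩ := eventually_nhds_iff_ball.1 (notMem_tsupport_iff_eventuallyEq.1 hx)
  obtain ⟨k', hk', hk'k⟩ := exists_contDiff_eqOn_compl_ball hk (half_pos hr)
  refine ⟨k', hk', ?_, fun t ht => ?_⟩
  · filter_upwards [ball_mem_nhds x (half_pos hr)] with y hy
    refine integral_congr_ae (Eventually.of_forall fun t => ?_)
    by_cases ht : t ∈ ball 0 (r / 2)
    · have hyt : y - t ∈ ball x r := by
        rw [mem_ball_iff_norm] at hy ⊢
        rw [mem_ball_zero_iff] at ht
        rw [sub_right_comm]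
        exact (norm_sub_le _ _).trans_lt (by linarith)
      simp only [show f (y - t) = 0 from hball _ hyt, map_zero]
    · simp only [hk'k ht]
  · have htr : r ≤ ‖t‖ := by
      by_contra! htr
      have hxt : x - t ∈ ball x r := by rwa [mem_ball_iff_norm, sub_sub_cancel_left, norm_neg]
      exact ht (hball _ hxt)
    refine ⟨norm_pos_iff.1 (hr.trans_le htr), ?_⟩
    filter_upwards [continuous_norm.continuousAt.eventually_const_lt
      ((half_lt_self hr).trans_le htr)] with z hz
    exact hk'k (by simpa using hz.le)

end Localization

section OffSupport

variable {V : Type*} [NormedAddCommGroup V] [InnerProductSpace ℝ V] [FiniteDimensional ℝ V]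
  {F F' G : Type*} [NormedAddCommGroup F] [NormedSpace ℝ F] [NormedAddCommGroup F']
  [NormedSpace ℝ F'] [NormedAddCommGroup G] [NormedSpace ℝ G]
  [MeasurableSpace V] [BorelSpace V] {μ : Measure V} [μ.IsAddHaarMeasure]
  [CompleteSpace G] {k : V → F} {f : V → F'} {B : ℝ} {x : V}

theorem contDiffAt_convolution_of_notMem_tsupport (L : F →L[ℝ] F' →L[ℝ] G)
    (hV : 2 ≤ Module.finrank ℝ V) (hk : ContDiffOn ℝ 2 k {0}ᶜ)
    (hf : AEStronglyMeasurable f μ) (hB : ∀ y, ‖f y‖ ≤ B) (hfc : HasCompactSupport f)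
    (hx : x ∉ tsupport f) : ContDiffAt ℝ 2 (k ⋆[L, μ] f) x := by
  obtain ⟨k', hk', heq, -⟩ := exists_contDiff_convolution_eventuallyEq (n := 2) (μ := μ) L hk hx
  exact (contDiff_two_convolution_left L hV hk' hf hB hfc).contDiffAt.congr_of_eventuallyEq heq

theorem laplacian_convolution_of_notMem_tsupport (L : F →L[ℝ] F' →L[ℝ] G)
    (hV : 2 ≤ Module.finrank ℝ V) (hk : ContDiffOn ℝ 2 k {0}ᶜ)
    (hf : AEStronglyMeasurable f μ) (hB : ∀ y, ‖f y‖ ≤ B) (hfc : HasCompactSupport f)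
    (hx : x ∉ tsupport f) (hΔ : ∀ z ≠ 0, (Δ k) z = 0) : (Δ (k ⋆[L, μ] f)) x = 0 := by
  obtain ⟨k', hk', heq, hk'k⟩ := exists_contDiff_convolution_eventuallyEq (n := 2) (μ := μ) L hk hx
  rw [(InnerProductSpace.laplacian_congr_nhds heq).eq_of_nhds,
    laplacian_convolution_left L hV hk' hf hB hfc]
  refine integral_eq_zero_of_ae (Eventually.of_forall fun t => ?_)
  by_cases ht : f (x - t) = 0
  · simp only [ht, map_zero, Pi.zero_apply]
  · obtain ⟨ht0, hkt⟩ := hk'k t ht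
    simp only [(InnerProductSpace.laplacian_congr_nhds hkt).eq_of_nhds, hΔ t ht0, map_zero,
      zero_apply, Pi.zero_apply]

end OffSupport

section FundamentalSolution

variable {m : ℕ}

theorem sphereArea_eq_mul_volume_ball (hm : m ≠ 0) :
    sphereArea m = m * (volume : Measure (Euc m)).real (ball 0 1) := by
  have : Nonempty (Fin m) := ⟨⟨0, Nat.pos_of_ne_zero hm⟩⟩
  have hm0 : (0 : ℝ) < m := by exact_mod_cast Nat.pos_of_ne_zero hm
  have := Real.Gamma_pos_of_pos (half_pos hm0)
  rw [measureReal_def, EuclideanSpace.volume_ball, Fintype.card_fin,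
    Real.Gamma_add_one (by positivity), ENNReal.ofReal_one, one_pow, one_mul,
    ENNReal.toReal_ofReal (by positivity), sphereArea, Real.sqrt_eq_rpow, ← Real.rpow_natCast,
    ← Real.rpow_mul Real.pi_pos.le, one_div_mul_eq_div]
  field_simp

theorem sphereArea_pos (hm : m ≠ 0) : 0 < sphereArea m := by
  have := Real.Gamma_pos_of_pos (half_pos (Nat.cast_pos'.2 (Nat.pos_of_ne_zero hm)))
  unfold sphereArea
  positivity

theorem fundamentalSolution_eq (m : ℕ) :
    fundamentalSolution m = ((2 - m : ℝ) * sphereArea m)⁻¹ • fun z => (‖z‖ ^ (m - 2))⁻¹ := by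
  ext z
  rw [fundamentalSolution, mul_inv _ (‖z‖ ^ _), Pi.smul_apply, smul_eq_mul]

theorem measurable_fundamentalSolution (m : ℕ) : Measurable (fundamentalSolution m) := by
  unfold fundamentalSolution
  fun_prop

theorem fundamentalSolution_sub_comm (x y : Euc m) :
    fundamentalSolution m (x - y) = fundamentalSolution m (y - x) := by
  rw [fundamentalSolution, fundamentalSolution, norm_sub_rev]

theorem contDiffOn_fundamentalSolution (m : ℕ) {n : WithTop ℕ∞} :
    ContDiffOn ℝ n (fundamentalSolution m) {0}ᶜ := by
  rw [fundamentalSolution_eq]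
  exact fun z hz =>
    ((contDiffAt_norm_pow_inv (m - 2) hz).const_smul ((2 - m : ℝ) * _)⁻¹).contDiffWithinAt

theorem fderiv_fundamentalSolution (hm : 3 ≤ m) {z : Euc m} (hz : z ≠ 0) :
    fderiv ℝ (fundamentalSolution m) z =
      (sphereArea m)⁻¹ • innerSL ℝ ((‖z‖ ^ Module.finrank ℝ (Euc m))⁻¹ • z) := by
  have hm' : (m : ℝ) - 2 ≠ 0 := sub_ne_zero.2 (by norm_cast; omega)
  have hc : ((2 - m : ℝ) * sphereArea m)⁻¹ * -(m - 2 : ℕ) = (sphereArea m)⁻¹ := by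
    rw [Nat.cast_sub (by omega), Nat.cast_two, mul_neg, ← neg_mul, ← inv_neg, ← neg_mul, neg_sub,
      mul_inv_rev, inv_mul_cancel_right₀ hm']
  rw [fundamentalSolution_eq, ((hasFDerivAt_norm_pow_inv (m - 2) hz).const_smul _).fderiv,
    Nat.sub_add_cancel (by omega), ← neg_mul, finrank_euclideanSpace_fin, map_smul, smul_smul,
    smul_smul, ← mul_assoc, hc]

theorem laplacian_fundamentalSolution (hm : 2 ≤ m) {z : Euc m} (hz : z ≠ 0) :
    (Δ (fundamentalSolution m)) z = 0 := by
  rw [fundamentalSolution_eq, InnerProductSpace.laplacian_smul _ (contDiffAt_norm_pow_inv _ hz),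
    laplacian_norm_pow_inv _ hz, finrank_euclideanSpace_fin, Nat.cast_sub hm, Nat.cast_two,
    sub_add_cancel, sub_self, mul_zero, zero_mul, smul_zero]

theorem locallyIntegrable_fundamentalSolution (hm : 2 ≤ m) :
    LocallyIntegrable (fundamentalSolution m) := by
  rw [fundamentalSolution_eq]
  exact (locallyIntegrable_norm_pow_inv (by rw [finrank_euclideanSpace_fin]; omega)).smul _

theorem locallyIntegrable_fderiv_fundamentalSolution (hm : 3 ≤ m) :
    LocallyIntegrable (fderiv ℝ (fundamentalSolution m)) := by
  have : Nontrivial (Euc m) := Module.nontrivial_of_finrank_pos (R := ℝ)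
    (by rw [finrank_euclideanSpace_fin]; omega)
  refine (locallyIntegrable_norm_pow_inv_smul.smul (sphereArea m)⁻¹).mono
    (measurable_fderiv ℝ _).aestronglyMeasurable ?_
  filter_upwards [measure_eq_zero_iff_ae_notMem.1 (measure_singleton (0 : Euc m))] with z hz
  rw [fderiv_fundamentalSolution hm hz, Pi.smul_apply, norm_smul, innerSL_apply_norm,
    norm_smul (sphereArea m)⁻¹]

theorem laplacian_convolution_fundamentalSolution_of_contDiff (hm : 3 ≤ m) {g : Euc m → ℝ}
    (hg : ContDiff ℝ 1 g) (hgc : HasCompactSupport g) (x : Euc m) :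
    (Δ (fundamentalSolution m ⋆[.mul ℝ ℝ] g)) x = g x := by
  have hfin := finrank_euclideanSpace_fin (𝕜 := ℝ) (n := m)
  have : Nontrivial (Euc m) := Module.nontrivial_of_finrank_pos (R := ℝ) (by rw [hfin]; omega)
  have hS := sphereArea_pos (m := m) (by omega)
  let b := stdOrthonormalBasis ℝ (Euc m)
  calc (Δ (fundamentalSolution m ⋆[.mul ℝ ℝ] g)) x
      = ∫ t, ∑ i, fderiv ℝ (fundamentalSolution m) t (b i) * fderiv ℝ g (x - t) (b i) :=
        laplacian_convolution_right b _ (by rw [hfin]; omega)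
          (locallyIntegrable_fundamentalSolution (by omega)) (contDiffOn_fundamentalSolution m)
          (locallyIntegrable_fderiv_fundamentalSolution hm) hg hgc x
    _ = ∫ t, (sphereArea m)⁻¹ *
          fderiv ℝ g (x - t) ((‖t‖ ^ Module.finrank ℝ (Euc m))⁻¹ • t) := by
        refine integral_congr_ae ?_
        filter_upwards [measure_eq_zero_iff_ae_notMem.1 (measure_singleton (0 : Euc m))] with t ht
        simp_rw [fderiv_fundamentalSolution hm ht, smul_apply, innerSL_apply_apply, smul_eq_mul,
          mul_assoc, ← Finset.mul_sum]
        congr 1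
        conv_rhs => rw [← b.sum_repr' ((‖t‖ ^ _)⁻¹ • t), map_sum]
        simp_rw [map_smul, smul_eq_mul, real_inner_comm]
    _ = (sphereArea m)⁻¹ * (((fun z : Euc m => (‖z‖ ^ Module.finrank ℝ (Euc m))⁻¹ • z)
          ⋆[ContinuousLinearMap.apply ℝ ℝ] fderiv ℝ g) x) := integral_const_mul _ _
    _ = g x := by
        rw [convolution_norm_pow_inv_smul_fderiv hg hgc, hfin,
          ← sphereArea_eq_mul_volume_ball (by omega), smul_eq_mul, inv_mul_cancel_left₀ hS.ne']

theorem contDiffAt_and_laplacian_convolution_fundamentalSolution (hm : 3 ≤ m) {f : Euc m → ℝ}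
    {B : ℝ} (hf : AEStronglyMeasurable f) (hB : ∀ y, ‖f y‖ ≤ B) (hfc : HasCompactSupport f)
    {x : Euc m} (hfx : ContDiffAt ℝ 1 f x) :
    ContDiffAt ℝ 2 (fundamentalSolution m ⋆[.mul ℝ ℝ] f) x ∧
      (Δ (fundamentalSolution m ⋆[.mul ℝ ℝ] f)) x = f x := by
  have hE : 2 ≤ Module.finrank ℝ (Euc m) := by rw [finrank_euclideanSpace_fin]; omega
  have hk := locallyIntegrable_fundamentalSolution (m := m) (by omega)
  have hkd := fun n => contDiffOn_fundamentalSolution m (n := n)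
  obtain ⟨g, hg, hgc, hgf⟩ := exists_contDiff_hasCompactSupport_eventuallyEq (n := 1) hfx
  obtain ⟨B', hB'⟩ := hgc.exists_bound_of_continuous hg.continuous
  have hfg := hf.sub hg.continuous.aestronglyMeasurable
  have hfgB (y : Euc m) : ‖(f - g) y‖ ≤ B + B' :=
    (norm_sub_le _ _).trans (add_le_add (hB y) (hB' y))
  have hfgc : HasCompactSupport (f - g) := hfc.sub hgc
  have hx : x ∉ tsupport (f - g) := notMem_tsupport_iff_eventuallyEq.2 <| by
    filter_upwards [hgf] with y hy using sub_eq_zero.2 hy.symm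
  have hsplit : fundamentalSolution m ⋆[.mul ℝ ℝ] f =
      (fundamentalSolution m ⋆[.mul ℝ ℝ] g) + (fundamentalSolution m ⋆[.mul ℝ ℝ] (f - g)) := by
    rw [← ConvolutionExists.distrib_add
      (convolutionExists_of_bounded _ hk hg.continuous.aestronglyMeasurable hB' hgc)
      (convolutionExists_of_bounded _ hk hfg hfgB hfgc), add_sub_cancel]
  have hnear := (contDiff_two_convolution_right (.mul ℝ ℝ) hE hk (hkd 1)
    (locallyIntegrable_fderiv_fundamentalSolution hm) hg hgc).contDiffAt (x := x)
  have hfar := contDiffAt_convolution_of_notMem_tsupport (.mul ℝ ℝ) hE (hkd 2) hfg hfgB hfgc hx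
  rw [hsplit]
  refine ⟨hnear.add hfar, ?_⟩
  rw [hnear.laplacian_add hfar, laplacian_convolution_fundamentalSolution_of_contDiff hm hg hgc,
    laplacian_convolution_of_notMem_tsupport (.mul ℝ ℝ) hE (hkd 2) hfg hfgB hfgc hx
      fun z hz => laplacian_fundamentalSolution (by omega) hz, add_zero, hgf.eq_of_nhds]

end FundamentalSolution

section ConvolutionKernel

variable {G F : Type*} [NormedAddCommGroup G] [ProperSpace G] [MeasurableSpace G] [BorelSpace G]
  [NormedAddCommGroup F] {μ : Measure G} [μ.IsAddHaarMeasure] {k : G → F}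

theorem exists_setLIntegral_enorm_sub_le (hk : LocallyIntegrable k μ) {S D : Set G}
    (hS : Bornology.IsBounded S) (hD : Bornology.IsBounded D) :
    ∃ R ≠ ∞, ∀ x ∈ S, ∫⁻ y in D, ‖k (x - y)‖ₑ ∂μ ≤ R := by
  have hK : IsCompact (closure (S - D)) := (hS.sub hD).isCompact_closure
  refine ⟨∫⁻ z in closure (S - D), ‖k z‖ₑ ∂μ, (hk.integrableOn_isCompact hK).2.ne,
    fun x hx => ?_⟩
  calc ∫⁻ y in D, ‖k (x - y)‖ₑ ∂μ
      ≤ ∫⁻ y in (x - ·) ⁻¹' closure (S - D), ‖k (x - y)‖ₑ ∂μ :=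
        lintegral_mono_set fun y hy => subset_closure (sub_mem_sub hx hy)
    _ = ∫⁻ z in closure (S - D), ‖k z‖ₑ ∂μ :=
        (Measure.measurePreserving_sub_left μ x).setLIntegral_comp_preimage_emb
          (MeasurableEquiv.subLeft x).measurableEmbedding (fun z => ‖k z‖ₑ) _

end ConvolutionKernel

section NewtonianOperator

variable {m : ℕ} {D : Set (Euc m)}

theorem exists_ae_lintegral_fundamentalSolution_le (hm : 2 ≤ m) (hDm : MeasurableSet D)
    (hD : Bornology.IsBounded D) :
    ∃ R ≠ ∞, ∀ᵐ x ∂volume.restrict D, ∫⁻ y in D, ‖fundamentalSolution m (x - y)‖ₑ ≤ R := by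
  obtain ⟨R, hR, hrow⟩ :=
    exists_setLIntegral_enorm_sub_le (locallyIntegrable_fundamentalSolution hm) hD hD
  exact ⟨R, hR, ae_restrict_of_forall_mem hDm hrow⟩

theorem exists_isNewtonianOperator (hm : 2 ≤ m) (hDm : MeasurableSet D)
    (hD : Bornology.IsBounded D) : ∃ T : L2 D →L[ℝ] L2 D, IsNewtonianOperator D T := by
  obtain ⟨R, hR, hrow⟩ := exists_ae_lintegral_fundamentalSolution_le hm hDm hD
  exact exists_kernel_operator (K := fun x y => fundamentalSolution m (x - y))
    ((measurable_fundamentalSolution m).comp measurable_sub) hrow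
    (by simpa only [fundamentalSolution_sub_comm] using hrow) hR hR

theorem isPosSemidefKernel_neg_fundamentalSolution (hm : 3 ≤ m) (ν : Measure (Euc m)) [SFinite ν]
    [NullSingletonClass ν] : IsPosSemidefKernel (fun x y => -fundamentalSolution m (x - y)) ν := by
  have hm2 : (2 : ℝ) < m := by exact_mod_cast hm
  have hc : 0 ≤ -((2 - m : ℝ) * sphereArea m)⁻¹ := by
    rw [← inv_neg, ← neg_mul, neg_sub]
    exact inv_nonneg.2 (mul_nonneg (by linarith) (sphereArea_pos (by omega)).le)
  have hK (x y : Euc m) : -fundamentalSolution m (x - y) =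
      -((2 - m : ℝ) * sphereArea m)⁻¹ * ‖x - y‖ ^ (-((m - 2 : ℕ) : ℝ)) := by
    rw [fundamentalSolution_eq, Pi.smul_apply, smul_eq_mul, neg_mul,
      Real.rpow_neg (norm_nonneg _), Real.rpow_natCast]
  simp_rw [hK]
  exact (isPosSemidefKernel_norm_rpow (Nat.cast_pos.2 (by omega))).const_mul hc

theorem IsNewtonianOperator.inner_nonpos {T : L2 D →L[ℝ] L2 D} (hT : IsNewtonianOperator D T)
    (hm : 3 ≤ m) (hDm : MeasurableSet D) (hD : Bornology.IsBounded D) (f : L2 D) :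
    inner ℝ (T f) f ≤ 0 := by
  have : Nontrivial (Euc m) := Module.nontrivial_of_finrank_pos (R := ℝ)
    (by rw [finrank_euclideanSpace_fin]; omega)
  obtain ⟨R, hR, hrow⟩ := exists_ae_lintegral_fundamentalSolution_le (m := m) (by omega) hDm hD
  have hint := integrable_prod_kernel_mul_mul (K := fun x y => fundamentalSolution m (x - y))
    ((measurable_fundamentalSolution m).comp measurable_sub) hrow
    (by simpa only [fundamentalSolution_sub_comm] using hrow) hR hR (Lp.memLp f) (Lp.memLp f)
  rw [← neg_nonneg, ← inner_neg_left]
  refine (isPosSemidefKernel_neg_fundamentalSolution hm _).inner_nonneg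
    (by simpa only [neg_mul] using hint.fun_neg) ?_
  filter_upwards [Lp.coeFn_neg (T f), hT f] with x hx hTx
  simp only [hx, Pi.neg_apply, hTx.2, newtonianPotential, neg_mul, integral_neg]

theorem isUnit_one_sub_smul_of_inner_nonpos {H : Type*} [NormedAddCommGroup H]
    [InnerProductSpace ℝ H] [CompleteSpace H] {T : H →L[ℝ] H} (hT : ∀ f, inner ℝ (T f) f ≤ 0)
    {c : ℝ} (hc : 0 ≤ c) : IsUnit (1 - c • T) := by
  refine ContinuousLinearMap.isUnit_of_forall_le_norm_inner_map _ one_pos fun f => ?_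
  calc ‖f‖ ^ 2 * (1 : ℝ≥0) ≤ ‖f‖ ^ 2 - c * inner ℝ (T f) f := by
        rw [NNReal.coe_one, mul_one]
        linarith [mul_nonpos_of_nonneg_of_nonpos hc (hT f)]
    _ = inner ℝ ((1 - c • T) f) f := by
        simp [inner_sub_left, inner_smul_left]
    _ ≤ _ := le_abs_self _

end NewtonianOperator

section CompactOperator

open scoped BoundedContinuousFunction

variable {E F X : Type*} [NormedAddCommGroup E] [NormedSpace ℝ E] [NormedAddCommGroup F]
  [NormedSpace ℝ F] [PseudoMetricSpace X] [CompactSpace X]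

theorem isCompactOperator_of_dist_apply_le [ProperSpace F] (S : E →L[ℝ] X →ᵇ F) {L : ℝ}
    (hL0 : 0 ≤ L) (hL : ∀ f x y, dist (S f x) (S f y) ≤ L * ‖f‖ * dist x y) :
    IsCompactOperator S := by
  refine ⟨closure (S '' ball 0 1), ?_, mem_of_superset (ball_mem_nhds _ one_pos)
    fun f hf => subset_closure (mem_image_of_mem _ hf)⟩
  refine BoundedContinuousFunction.arzela_ascoli (closedBall 0 ‖S‖) (isCompact_closedBall _ _) _
    ?_ (LipschitzWith.uniformEquicontinuous _ L.toNNReal ?_).equicontinuous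
  · rintro _ x ⟨f, hf, rfl⟩
    rw [mem_closedBall_zero_iff]
    exact ((S f).norm_coe_le_norm x).trans (S.unit_le_opNorm f (mem_ball_zero_iff.1 hf).le)
  · rintro ⟨_, f, hf, rfl⟩
    refine LipschitzWith.of_dist_le_mul fun x y => (hL f x y).trans ?_
    rw [Real.coe_toNNReal _ hL0]
    gcongr
    exact mul_le_of_le_one_right hL0 (mem_ball_zero_iff.1 hf).le

theorem exists_isCompactOperator_of_dist_apply_le [ProperSpace F] (A : E →ₗ[ℝ] X → F) {M L : ℝ}
    (hM0 : 0 ≤ M) (hM : ∀ f x, ‖A f x‖ ≤ M * ‖f‖)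
    (hL0 : 0 ≤ L) (hL : ∀ f x y, dist (A f x) (A f y) ≤ L * ‖f‖ * dist x y) :
    ∃ S : E →L[ℝ] X →ᵇ F, IsCompactOperator S ∧ ∀ f x, S f x = A f x := by
  have hcont (f : E) : Continuous (A f) :=
    (LipschitzWith.of_dist_le_mul (K := (L * ‖f‖).toNNReal) fun x y => by
      rw [Real.coe_toNNReal _ (by positivity)]; exact hL f x y).continuous
  let S₀ : E →ₗ[ℝ] X →ᵇ F :=
    { toFun := fun f => .mkOfCompact ⟨A f, hcont f⟩
      map_add' := fun f g => by ext x; simp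
      map_smul' := fun c f => by ext x; simp }
  let S := S₀.mkContinuous M fun f =>
    (BoundedContinuousFunction.norm_le (by positivity)).2 (hM f)
  exact ⟨S, isCompactOperator_of_dist_apply_le S hL0 hL, fun _ _ => rfl⟩

theorem surjective_sub_of_isCompactOperator [CompleteSpace E] {S : E →L[ℝ] E}
    (hS : IsCompactOperator S) (h0 : ∀ f, S f = f → f = 0) :
    Function.Surjective fun f => f - S f := by
  have hres : (1 : ℝ) ∈ resolventSet ℝ S := by
    refine (hS.hasEigenvalue_or_mem_resolventSet one_ne_zero).resolve_left fun he => ?_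
    obtain ⟨f, hf⟩ := he.exists_hasEigenvector
    exact hf.2 (h0 f (hf.apply_eq_smul.trans (one_smul ℝ f)))
  rw [spectrum.mem_resolventSet_iff, map_one] at hres
  exact (ContinuousLinearMap.isUnit_iff_bijective.1 hres).2

end CompactOperator

section BoundedSet

variable {X F : Type*} [NormedAddCommGroup F] {D : Set X} {u : X → F}

theorem norm_indicator_le_of_forall_mem {B : ℝ} (hB0 : 0 ≤ B) (hB : ∀ y ∈ D, ‖u y‖ ≤ B) (y : X) :
    ‖D.indicator u y‖ ≤ B := by
  by_cases hy : y ∈ D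
  · rw [Set.indicator_of_mem hy]
    exact hB y hy
  · rwa [Set.indicator_of_notMem hy, norm_zero]

variable [PseudoMetricSpace X] [ProperSpace X]

theorem hasCompactSupport_indicator (hD : Bornology.IsBounded D) (u : X → F) :
    HasCompactSupport (D.indicator u) :=
  hD.isCompact_closure.of_isClosed_subset (isClosed_tsupport _)
    (closure_mono Set.support_indicator_subset)

theorem exists_norm_le_of_continuousOn_closure (hD : Bornology.IsBounded D)
    (hu : ContinuousOn u (closure D)) : ∃ B, 0 ≤ B ∧ ∀ y ∈ closure D, ‖u y‖ ≤ B := by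
  obtain ⟨B, hB⟩ := hD.isCompact_closure.exists_bound_of_continuousOn hu
  exact ⟨|B|, abs_nonneg B, fun y hy => (hB y hy).trans (le_abs_self B)⟩

theorem exists_norm_indicator_le (hD : Bornology.IsBounded D) (hu : ContinuousOn u (closure D)) :
    ∃ B, ∀ y, ‖D.indicator u y‖ ≤ B := by
  obtain ⟨B, hB0, hB⟩ := exists_norm_le_of_continuousOn_closure hD hu
  exact ⟨B, norm_indicator_le_of_forall_mem hB0 fun y hy => hB y (subset_closure hy)⟩

variable [MeasurableSpace X] [OpensMeasurableSpace X] {ν : Measure X}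

theorem aestronglyMeasurable_indicator_of_continuousOn_closure (hDm : MeasurableSet D)
    (hu : ContinuousOn u (closure D)) : AEStronglyMeasurable (D.indicator u) ν :=
  (aestronglyMeasurable_indicator_iff hDm).2 ((hu.mono subset_closure).aestronglyMeasurable hDm)

theorem memLp_of_continuousOn_closure [IsFiniteMeasureOnCompacts ν] (hDm : MeasurableSet D)
    (hD : Bornology.IsBounded D) (hu : ContinuousOn u (closure D)) (p : ℝ≥0∞) :
    MemLp u p (ν.restrict D) := by
  have : IsFiniteMeasure (ν.restrict D) := ⟨by simpa using hD.measure_lt_top⟩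
  obtain ⟨B, -, hB⟩ := exists_norm_le_of_continuousOn_closure hD hu
  exact MemLp.of_bound ((hu.mono subset_closure).aestronglyMeasurable hDm) B
    (ae_restrict_of_forall_mem hDm fun y hy => hB y (subset_closure hy))

end BoundedSet

section NewtonianPotential

variable {m : ℕ} {D S : Set (Euc m)} {u v : Euc m → ℝ}

theorem newtonianPotential_eq_convolution (hDm : MeasurableSet D) (u : Euc m → ℝ) :
    newtonianPotential D u = fundamentalSolution m ⋆[.mul ℝ ℝ] D.indicator u := by
  ext x
  rw [convolution_mul_swap, newtonianPotential, ← integral_indicator hDm]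
  simp only [Set.indicator_mul_right]

theorem integrableOn_fundamentalSolution_mul (hm : 2 ≤ m) (hDm : MeasurableSet D)
    (hD : Bornology.IsBounded D) (hu : ContinuousOn u (closure D)) (x : Euc m) :
    IntegrableOn (fun y => fundamentalSolution m (x - y) * u y) D := by
  obtain ⟨B, hB⟩ := exists_norm_indicator_le hD hu
  have h := convolutionExists_of_bounded (.mul ℝ ℝ) (locallyIntegrable_fundamentalSolution hm)
    (aestronglyMeasurable_indicator_of_continuousOn_closure hDm hu) hB
    (hasCompactSupport_indicator hD u) x
  rw [convolutionExistsAt_iff_integrable_swap] at h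
  rw [← integrable_indicator_iff hDm]
  exact h.congr (.of_forall fun y => (Set.indicator_mul_right D (fun y =>
    fundamentalSolution m (x - y)) u).symm)

theorem newtonianPotential_add (hm : 2 ≤ m) (hDm : MeasurableSet D)
    (hD : Bornology.IsBounded D) (hu : ContinuousOn u (closure D))
    (hv : ContinuousOn v (closure D)) :
    newtonianPotential D (u + v) = newtonianPotential D u + newtonianPotential D v := by
  ext x
  simp only [newtonianPotential, Pi.add_apply, mul_add]
  exact integral_add (integrableOn_fundamentalSolution_mul hm hDm hD hu x)
    (integrableOn_fundamentalSolution_mul hm hDm hD hv x)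

theorem newtonianPotential_smul (c : ℝ) (u : Euc m → ℝ) :
    newtonianPotential D (c • u) = c • newtonianPotential D u := by
  ext x
  simp only [newtonianPotential, Pi.smul_apply, smul_eq_mul, mul_left_comm, integral_const_mul]

theorem newtonianPotential_congr_ae (h : u =ᵐ[volume.restrict D] v) :
    newtonianPotential D u = newtonianPotential D v := by
  ext x
  refine integral_congr_ae ?_
  filter_upwards [h] with y hy using by rw [hy]

theorem exists_norm_newtonianPotential_le (hm : 2 ≤ m) (hDm : MeasurableSet D)
    (hD : Bornology.IsBounded D) (hS : Bornology.IsBounded S) :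
    ∃ M : ℝ, 0 ≤ M ∧ ∀ (u : Euc m → ℝ) (B : ℝ), 0 ≤ B → (∀ y ∈ D, ‖u y‖ ≤ B) →
      ∀ x ∈ S, ‖newtonianPotential D u x‖ ≤ M * B := by
  obtain ⟨M, hM0, hM⟩ := exists_norm_convolution_le (.mul ℝ ℝ)
    (locallyIntegrable_fundamentalSolution hm) hS hD
  refine ⟨M, hM0, fun u B hB0 hB => ?_⟩
  rw [newtonianPotential_eq_convolution hDm]
  exact hM _ B (norm_indicator_le_of_forall_mem hB0 hB) Set.support_indicator_subset

theorem exists_lipschitz_newtonianPotential (hm : 3 ≤ m) (hDm : MeasurableSet D)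
    (hD : Bornology.IsBounded D) (hS : Bornology.IsBounded S) :
    ∃ M : ℝ, 0 ≤ M ∧ ∀ (u : Euc m → ℝ) (B : ℝ), ContinuousOn u (closure D) → 0 ≤ B →
      (∀ y ∈ D, ‖u y‖ ≤ B) → ∀ x ∈ S, ∀ y ∈ S,
        ‖newtonianPotential D u x - newtonianPotential D u y‖ ≤ M * B * ‖x - y‖ := by
  obtain ⟨M, hM0, hM⟩ := exists_lipschitz_convolution (μ := (volume : Measure (Euc m)))
    (.mul ℝ ℝ) (by rw [finrank_euclideanSpace_fin]; omega)
    (locallyIntegrable_fundamentalSolution (by omega)) (contDiffOn_fundamentalSolution m)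
    (locallyIntegrable_fderiv_fundamentalSolution hm) hS hD
  refine ⟨M, hM0, fun u B hu hB0 hB => ?_⟩
  rw [newtonianPotential_eq_convolution hDm]
  exact hM _ B (aestronglyMeasurable_indicator_of_continuousOn_closure hDm hu)
    (norm_indicator_le_of_forall_mem hB0 hB) Set.support_indicator_subset

theorem contDiff_newtonianPotential (hm : 3 ≤ m) (hDm : MeasurableSet D)
    (hD : Bornology.IsBounded D) (hu : ContinuousOn u (closure D)) :
    ContDiff ℝ 1 (newtonianPotential D u) := by
  obtain ⟨B, hB⟩ := exists_norm_indicator_le hD hu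
  have hf : AEStronglyMeasurable (D.indicator u) :=
    aestronglyMeasurable_indicator_of_continuousOn_closure hDm hu
  have hfc := hasCompactSupport_indicator hD u
  have hderiv := hasFDerivAt_convolution_of_contDiffOn_compl (μ := (volume : Measure (Euc m)))
    (.mul ℝ ℝ) (by rw [finrank_euclideanSpace_fin]; omega)
    (locallyIntegrable_fundamentalSolution (by omega)) (contDiffOn_fundamentalSolution m)
    (locallyIntegrable_fderiv_fundamentalSolution hm) hf hB hfc
  rw [newtonianPotential_eq_convolution hDm, contDiff_one_iff_hasFDerivAt]
  exact ⟨_, continuous_convolution_of_bounded _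
    (locallyIntegrable_fderiv_fundamentalSolution hm) hf hB hfc, hderiv⟩

theorem contDiffAt_and_laplacian_newtonianPotential (hm : 3 ≤ m) (ho : IsOpen D)
    (hD : Bornology.IsBounded D) (hu : ContinuousOn u (closure D)) {x : Euc m} (hx : x ∈ D)
    (hux : ContDiffAt ℝ 1 u x) :
    ContDiffAt ℝ 2 (newtonianPotential D u) x ∧ (Δ (newtonianPotential D u)) x = u x := by
  obtain ⟨B, hB⟩ := exists_norm_indicator_le hD hu
  have hloc : D.indicator u =ᶠ[𝓝 x] u :=
    (Set.eqOn_indicator (f := u)).eventuallyEq_of_mem (ho.mem_nhds hx)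
  rw [newtonianPotential_eq_convolution ho.measurableSet, ← hloc.eq_of_nhds]
  exact contDiffAt_and_laplacian_convolution_fundamentalSolution hm
    (aestronglyMeasurable_indicator_of_continuousOn_closure ho.measurableSet hu) hB
    (hasCompactSupport_indicator hD u) (hux.congr_of_eventuallyEq hloc)

end NewtonianPotential

section IntegralEquation

variable {m : ℕ} {D : Set (Euc m)} {c : ℝ} {h u v : Euc m → ℝ}

theorem isPanharmonicOn_of_integral_equation (hm : 3 ≤ m) (ho : IsOpen D)
    (hD : Bornology.IsBounded D) (hu : ContinuousOn u (closure D)) {μ : ℝ}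
    (hh : InnerProductSpace.HarmonicOnNhd h D)
    (heq : ∀ x ∈ D, u x - μ ^ 2 * newtonianPotential D u x = h x) : IsPanharmonicOn μ u D := by
  have heqOn : EqOn u (h + μ ^ 2 • newtonianPotential D u) D :=
    fun x hx => sub_eq_iff_eq_add.1 (heq x hx)
  have hnhds : ∀ x ∈ D, u =ᶠ[𝓝 x] h + μ ^ 2 • newtonianPotential D u :=
    fun x hx => heqOn.eventuallyEq_of_mem (ho.mem_nhds hx)
  have hu1 : ∀ x ∈ D, ContDiffAt ℝ 1 u x := fun x hx =>
    (((hh x hx).1.of_le one_le_two).add ((contDiff_newtonianPotential hm ho.measurableSet hD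
      hu).contDiffAt.const_smul (μ ^ 2))).congr_of_eventuallyEq (hnhds x hx)
  have hpoisson x (hx : x ∈ D) :=
    contDiffAt_and_laplacian_newtonianPotential hm ho hD hu hx (hu1 x hx)
  have hsmul : ∀ x ∈ D, ContDiffAt ℝ 2 (μ ^ 2 • newtonianPotential D u) x :=
    fun x hx => (hpoisson x hx).1.const_smul (μ ^ 2)
  refine ⟨fun x hx => (((hh x hx).1.add (hsmul x hx)).congr_of_eventuallyEq
    (hnhds x hx)).contDiffWithinAt, fun x hx => ?_⟩
  rw [(InnerProductSpace.laplacian_congr_nhds (hnhds x hx)).eq_of_nhds,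
    (hh x hx).1.laplacian_add (hsmul x hx), (hh x hx).2.eq_of_nhds, Pi.zero_apply, zero_add,
    InnerProductSpace.laplacian_smul _ (hpoisson x hx).1, (hpoisson x hx).2, smul_eq_mul, sub_self]

theorem isHolderOnClosure_of_integral_equation (hm : 3 ≤ m) (hDm : MeasurableSet D)
    (hD : Bornology.IsBounded D) (hu : ContinuousOn u (closure D)) {α : ℝ≥0} (hα : α ≤ 1)
    (hh : IsHolderOnClosure α h D)
    (heq : ∀ x ∈ closure D, u x - c * newtonianPotential D u x = h x) :
    IsHolderOnClosure α u D := by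
  obtain ⟨C, hC⟩ := hh
  obtain ⟨L, hL0, hL⟩ := exists_lipschitz_newtonianPotential hm hDm hD hD.closure
  obtain ⟨B, hB0, hB⟩ := exists_norm_le_of_continuousOn_closure hD hu
  have hlip : LipschitzOnWith (|c| * (L * B)).toNNReal (fun x => c * newtonianPotential D u x)
      (closure D) := LipschitzOnWith.of_dist_le_mul fun x hx y hy => by
    rw [Real.coe_toNNReal _ (by positivity), dist_eq_norm, dist_eq_norm, ← mul_sub, norm_mul,
      mul_assoc]
    exact mul_le_mul_of_nonneg_left
      (hL u B hu hB0 (fun y hy => hB y (subset_closure hy)) x hx y hy) (abs_nonneg c)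
  obtain ⟨C', hC'⟩ := HolderOnWith.exists_holderOnWith_of_le
    ⟨_, holderOnWith_one.2 hlip⟩ hα hD.closure
  refine ⟨C + C', fun x hx y hy => ?_⟩
  rw [sub_eq_iff_eq_add.1 (heq x hx), sub_eq_iff_eq_add.1 (heq y hy), ENNReal.coe_add, add_mul]
  exact (edist_add_add_le _ _ _ _).trans (add_le_add (hC x hx y hy) (hC' x hx y hy))

theorem isL2Solution_of_continuousOn (hDm : MeasurableSet D) (hD : Bornology.IsBounded D)
    (hu : ContinuousOn u (closure D))
    (heq : ∀ x ∈ D, u x - c * newtonianPotential D u x = h x) : IsL2Solution D c h u :=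
  ⟨memLp_of_continuousOn_closure hDm hD hu 2, ae_restrict_of_forall_mem hDm heq⟩

theorem IsNewtonianOperator.one_sub_smul_toLp {T : L2 D →L[ℝ] L2 D} (hT : IsNewtonianOperator D T)
    (hh : MemLp h 2 (volume.restrict D)) (hu : IsL2Solution D c h u) :
    (1 - c • T) (hu.1.toLp u) = hh.toLp h := by
  have hsub : (1 - c • T) (hu.1.toLp u) = hu.1.toLp u - c • T (hu.1.toLp u) := rfl
  refine Lp.ext ?_
  rw [hsub]
  filter_upwards [Lp.coeFn_sub (hu.1.toLp u) (c • T (hu.1.toLp u)),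
    Lp.coeFn_smul c (T (hu.1.toLp u)), hT (hu.1.toLp u), hu.2, hu.1.coeFn_toLp,
    hh.coeFn_toLp] with x hsub hsmul hTx heq hux hhx
  rw [hsub, Pi.sub_apply, hsmul, Pi.smul_apply, hTx.2, hux, hhx, smul_eq_mul, ← heq,
    newtonianPotential_congr_ae hu.1.coeFn_toLp]

theorem IsNewtonianOperator.inverse_toLp_ae_eq {T R : L2 D →L[ℝ] L2 D}
    (hT : IsNewtonianOperator D T) (hR : R * (1 - c • T) = 1)
    (hh : MemLp h 2 (volume.restrict D)) (hu : IsL2Solution D c h u) :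
    R (hh.toLp h) =ᵐ[volume.restrict D] u := by
  rw [← hT.one_sub_smul_toLp hh hu, ← mul_apply_eq_comp, hR]
  exact hu.1.coeFn_toLp

theorem IsNewtonianOperator.eqOn_zero_of_continuousOn {T R : L2 D →L[ℝ] L2 D}
    (hT : IsNewtonianOperator D T) (hR : R * (1 - c • T) = 1) (ho : IsOpen D)
    (hD : Bornology.IsBounded D) (hu : ContinuousOn u (closure D))
    (heq : ∀ x ∈ D, u x - c * newtonianPotential D u x = 0) : EqOn u 0 (closure D) := by
  have hsol : IsL2Solution D c 0 u := isL2Solution_of_continuousOn ho.measurableSet hD hu heq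
  have hae : u =ᵐ[volume.restrict D] 0 := by
    have := hT.inverse_toLp_ae_eq hR MemLp.zero hsol
    rw [MemLp.toLp_zero, map_zero] at this
    exact this.symm.trans (Lp.coeFn_zero _ _ _)
  exact (Measure.eqOn_open_of_ae_eq hae ho (hu.mono subset_closure)
    continuousOn_const).of_subset_closure hu continuousOn_const subset_closure subset_rfl

end IntegralEquation

section ContinuousSolution

open scoped BoundedContinuousFunction

variable {m : ℕ} {D : Set (Euc m)} {c : ℝ} {h : Euc m → ℝ}

/-- Extension by zero of the functions on `closure D`. It turns a continuous function on the compact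
space `closure D` into one to which `newtonianPotential D` applies. -/
noncomputable def extendZero (D : Set (Euc m)) : (closure D → ℝ) →ₗ[ℝ] Euc m → ℝ :=
  Function.ExtendByZero.linearMap ℝ Subtype.val

theorem extendZero_apply (f : closure D → ℝ) (x : closure D) : extendZero D f x = f x :=
  Subtype.val_injective.extend_apply _ _ _

theorem continuousOn_extendZero {f : closure D → ℝ} (hf : Continuous f) :
    ContinuousOn (extendZero D f) (closure D) := by
  rw [continuousOn_iff_continuous_domRestrict]
  exact hf.congr fun x => (extendZero_apply f x).symm

theorem norm_extendZero_le (f : closure D →ᵇ ℝ) {x : Euc m} (hx : x ∈ D) :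
    ‖extendZero D f x‖ ≤ ‖f‖ :=
  (congr_arg norm (extendZero_apply f ⟨x, subset_closure hx⟩)).trans_le (f.norm_coe_le_norm _)

/-- The Newtonian potential over `D` as a linear map on the continuous functions on `closure D`. -/
noncomputable def continuousNewtonianPotential (hm : 2 ≤ m) (hDm : MeasurableSet D)
    (hD : Bornology.IsBounded D) : (closure D →ᵇ ℝ) →ₗ[ℝ] closure D → ℝ where
  toFun f x := newtonianPotential D (extendZero D f) x
  map_add' f g := by
    ext x
    rw [BoundedContinuousFunction.coe_add, map_add, newtonianPotential_add hm hDm hD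
      (continuousOn_extendZero f.continuous) (continuousOn_extendZero g.continuous)]
    rfl
  map_smul' a f := by
    ext x
    rw [BoundedContinuousFunction.coe_smul]
    exact congr_fun ((congr_arg (newtonianPotential D) (map_smul (extendZero D) a ⇑f)).trans
      (newtonianPotential_smul a _)) x

theorem exists_isCompactOperator_newtonianPotential (hm : 3 ≤ m) (hDm : MeasurableSet D)
    (hD : Bornology.IsBounded D) :
    ∃ S : (closure D →ᵇ ℝ) →L[ℝ] closure D →ᵇ ℝ, IsCompactOperator S ∧
      ∀ f x, S f x = newtonianPotential D (extendZero D f) x := by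
  have : CompactSpace (closure D) := isCompact_iff_compactSpace.1 hD.isCompact_closure
  have hm2 : 2 ≤ m := by omega
  obtain ⟨M, hM0, hM⟩ := exists_norm_newtonianPotential_le hm2 hDm hD hD.closure
  obtain ⟨L, hL0, hL⟩ := exists_lipschitz_newtonianPotential hm hDm hD hD.closure
  refine exists_isCompactOperator_of_dist_apply_le (continuousNewtonianPotential hm2 hDm hD)
    hM0 (fun f x => ?_) hL0 fun f x y => ?_
  · exact hM _ _ (norm_nonneg f) (fun y hy => norm_extendZero_le f hy) x x.2
  · rw [dist_eq_norm, Subtype.dist_eq, dist_eq_norm]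
    exact hL _ _ (continuousOn_extendZero f.continuous) (norm_nonneg f)
      (fun y hy => norm_extendZero_le f hy) x x.2 y y.2

theorem exists_continuousOn_solution (hm : 3 ≤ m) (hDm : MeasurableSet D)
    (hD : Bornology.IsBounded D)
    (h0 : ∀ u : Euc m → ℝ, ContinuousOn u (closure D) →
      (∀ x ∈ closure D, u x - c * newtonianPotential D u x = 0) → EqOn u 0 (closure D))
    (hh : ContinuousOn h (closure D)) :
    ∃ u : Euc m → ℝ, ContinuousOn u (closure D) ∧
      ∀ x ∈ closure D, u x - c * newtonianPotential D u x = h x := by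
  have : CompactSpace (closure D) := isCompact_iff_compactSpace.1 hD.isCompact_closure
  obtain ⟨S, hS, hSapply⟩ := exists_isCompactOperator_newtonianPotential hm hDm hD
  have hequation (f g : closure D →ᵇ ℝ) (hfg : f - (c • S) f = g) (x : closure D) :
      extendZero D f x - c * newtonianPotential D (extendZero D f) x = g x := by
    rw [← hSapply, extendZero_apply, ← hfg]
    rfl
  have hinj (f : closure D →ᵇ ℝ) (hf : (c • S) f = f) : f = 0 := by
    have hzero := h0 _ (continuousOn_extendZero f.continuous)
      fun x hx => hequation f 0 (by rw [hf, sub_self]) ⟨x, hx⟩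
    ext x
    rw [← extendZero_apply f x, hzero x.2]
    rfl
  obtain ⟨f, hf⟩ := surjective_sub_of_isCompactOperator (hS.smul c) hinj
    (.mkOfCompact ⟨(closure D).domRestrict h, continuousOn_iff_continuous_domRestrict.1 hh⟩)
  exact ⟨extendZero D f, continuousOn_extendZero f.continuous, fun x hx => hequation f _ hf ⟨x, hx⟩⟩

end ContinuousSolution

theorem theorem3p1_general (m : ℕ) (hm : 3 ≤ m) (D : Set (Euc m)) (ho : IsOpen D)
    (hD : Bornology.IsBounded D) :
    ∃ T : L2 D →L[ℝ] L2 D, IsNewtonianOperator D T ∧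
      ∀ μ : ℝ,
        ∃ R : L2 D →L[ℝ] L2 D,
          R * (1 - μ ^ 2 • T) = 1 ∧ (1 - μ ^ 2 • T) * R = 1 ∧
          ∀ α : ℝ≥0, 0 < α → α ≤ 1 →
            ∀ h : Euc m → ℝ, IsHolderOnClosure α h D → InnerProductSpace.HarmonicOnNhd h D →
              ∃ u : Euc m → ℝ,
                IsL2Solution D (μ ^ 2) h u ∧
                (∀ v : Euc m → ℝ, IsL2Solution D (μ ^ 2) h v →
                  v =ᵐ[volume.restrict D] u) ∧
                (∀ x ∈ D, IntegrableOn (fun y => fundamentalSolution m (x - y) * u y) D ∧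
                  u x - μ ^ 2 * newtonianPotential D u x = h x) ∧
                IsHolderOnClosure α u D ∧
                IsPanharmonicOn μ u D ∧
                ∃ hh : MemLp h 2 (volume.restrict D),
                  R (hh.toLp h) =ᵐ[volume.restrict D] u := by
  have hDm := ho.measurableSet
  obtain ⟨T, hT⟩ := exists_isNewtonianOperator (m := m) (by omega) hDm hD
  refine ⟨T, hT, fun μ => ?_⟩
  obtain ⟨R, hTR, hRT⟩ := isUnit_iff_exists.1
    (isUnit_one_sub_smul_of_inner_nonpos (hT.inner_nonpos hm hDm hD) (sq_nonneg μ))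
  refine ⟨R, hRT, hTR, fun α hα0 hα1 h hh hharm => ?_⟩
  have hhc : ContinuousOn h (closure D) := hh.elim fun _ hC => hC.continuousOn hα0
  have hmem : MemLp h 2 (volume.restrict D) := memLp_of_continuousOn_closure hDm hD hhc 2
  obtain ⟨u, huc, heq⟩ := exists_continuousOn_solution hm hDm hD
    (fun v hv hv0 => hT.eqOn_zero_of_continuousOn hRT ho hD hv
      fun x hx => hv0 x (subset_closure hx)) hhc
  have heqD : ∀ x ∈ D, u x - μ ^ 2 * newtonianPotential D u x = h x :=
    fun x hx => heq x (subset_closure hx)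
  have hsol := isL2Solution_of_continuousOn hDm hD huc heqD
  have hRu := hT.inverse_toLp_ae_eq hRT hmem hsol
  exact ⟨u, hsol, fun v hv => (hT.inverse_toLp_ae_eq hRT hmem hv).symm.trans hRu,
    fun x hx => ⟨integrableOn_fundamentalSolution_mul (by omega) hDm hD huc x, heqD x hx⟩,
    isHolderOnClosure_of_integral_equation hm hDm hD huc hα1 hh heq,
    isPanharmonicOn_of_integral_equation hm ho hD huc hharm heqD, hmem, hRu⟩

theorem theorem3p1 (m : ℕ) (hm : 3 ≤ m) (D : Set (Euc m)) (hD : IsBoundedLipschitzDomain D) :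
    ∃ T : L2 D →L[ℝ] L2 D, IsNewtonianOperator D T ∧
      ∀ μ : ℝ, μ ≠ 0 →
        ∃ R : L2 D →L[ℝ] L2 D,
          R * (1 - μ ^ 2 • T) = 1 ∧ (1 - μ ^ 2 • T) * R = 1 ∧
          ∀ α : ℝ≥0, 0 < α → α < 1 →
            ∀ h : Euc m → ℝ, IsHolderOnClosure α h D → InnerProductSpace.HarmonicOnNhd h D →
              ∃ u : Euc m → ℝ,
                IsL2Solution D (μ ^ 2) h u ∧
                (∀ v : Euc m → ℝ, IsL2Solution D (μ ^ 2) h v →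
                  v =ᵐ[volume.restrict D] u) ∧
                (∀ x ∈ D, IntegrableOn (fun y => fundamentalSolution m (x - y) * u y) D ∧
                  u x - μ ^ 2 * newtonianPotential D u x = h x) ∧
                IsHolderOnClosure α u D ∧
                IsPanharmonicOn μ u D ∧
                ∃ hh : MemLp h 2 (volume.restrict D),
                  R (hh.toLp h) =ᵐ[volume.restrict D] u := by
  obtain ⟨T, hT, hR⟩ := theorem3p1_general m hm D hD.isOpen hD.isBounded
  exact ⟨T, hT, fun μ _ => (hR μ).imp fun R h => ⟨h.1, h.2.1, fun α hα0 hα1 =>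
    h.2.2 α hα0 hα1.le⟩⟩
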